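/- Let $X$ and $Y$ be real Banach spaces and let $(E_n)_{n\ge 0}$ be a sequence of subsets of $X^*$ such that - each $E_n$ is $w^*$-locally relatively compact ($w^*$-LRC): for every $y\in E_n$ there is a $w^*$-open set $U\ni y$ such that the norm closure of $E_n\cap U$ is norm compact; - $E=\bigcup_{n=0}^\infty E_n$ is $\sigma$-$w^*$-compact, i.e. a countable union of $w^*$-compact sets; - $E$ contains a boundary of $X$, i.e. a set $B$ contained in the closed unit ball $B_{X^*}$ such that for every $x\in X$ with $\|x\|=1$ there is $f\in B$ with $f(x)=1$. Let $k\in\mathbb N\cup\{\infty\}$ and suppose that the norm $\|\cdot\|_Y$ of $Y$ is $C^k$ smooth, i.e. $k$ times continuously Fréchet differentiable (for all finite orders if $k=\infty$) on $Y\setminus\{0\}$. Let $X\otimes_\varepsilon Y$ be the injective tensor product, that is, the completion of the algebraic tensor product $X\otimes Y$ in the norm $$\Big\|\sum_{i=1}^m x_i\otimes y_i\Big\|=\sup\Big\{\Big|\sum_{i=1}^m f(x_i)g(y_i)\Big| : f\in B_{X^*},\ g\in B_{Y^*}\Big\}.$$ Then for every real $\varepsilon>0$ there is an equivalent norm $|||\cdot|||$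 on $X\otimes_\varepsilon Y$ that is $C^k$ smooth (on the complement of $0$) and satisfies $$(1-\varepsilon)\|u\|\le |||u|||\le(1+\varepsilon)\|u\|\qquad\text{for all } u\in X\otimes_\varepsilon Y,$$ where $\|\cdot\|$ is the canonical injective tensor norm. -/

import Mathlib

open scoped TensorProduct

noncomputable section

namespace SmoothRenorm

universe u v

/-! ### The injective tensor product -/

section InjectiveTensor

variable (X : Type u) (Y : Type v) [NormedAddCommGroup X] [NormedSpace ℝ X]
  [NormedAddCommGroup Y] [NormedSpace ℝ Y]

variable {X Y}

/-- The functional `f ⊗ g` on `X ⊗ Y`, determined by `(f ⊗ g) (x ⊗ y) = f x * g y`. -/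
def dualTensor (f : StrongDual ℝ X) (g : StrongDual ℝ Y) : X ⊗[ℝ] Y →ₗ[ℝ] ℝ :=
  TensorProduct.dualDistrib ℝ X Y ((f : X →ₗ[ℝ] ℝ) ⊗ₜ[ℝ] (g : Y →ₗ[ℝ] ℝ))

theorem dualTensor_tmul (f : StrongDual ℝ X) (g : StrongDual ℝ Y) (x : X) (y : Y) :
    dualTensor f g (x ⊗ₜ[ℝ] y) = f x * g y :=
  TensorProduct.dualDistrib_apply _ _ _ _

variable (X Y)

/-- The pairs `(f, g)` in `B_{X*} × B_{Y*}`. -/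
abbrev DualBalls : Type (max u v) :=
  Metric.closedBall (0 : StrongDual ℝ X) 1 × Metric.closedBall (0 : StrongDual ℝ Y) 1

instance : Nonempty (DualBalls X Y) :=
  ⟨⟨0, Metric.mem_closedBall_self zero_le_one⟩, ⟨0, Metric.mem_closedBall_self zero_le_one⟩⟩

variable {X Y}

theorem bddAbove_dualTensor (w : X ⊗[ℝ] Y) :
    BddAbove (Set.range fun p : DualBalls X Y => |dualTensor p.1.1 p.2.1 w|) := by
  suffices h : ∃ C : ℝ, ∀ p : DualBalls X Y, |dualTensor p.1.1 p.2.1 w| ≤ C by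
    obtain ⟨C, hC⟩ := h
    exact ⟨C, by rintro _ ⟨p, rfl⟩; exact hC p⟩
  induction w with
  | zero => exact ⟨0, fun p => by simp⟩
  | tmul x y =>
    refine ⟨‖x‖ * ‖y‖, fun p => ?_⟩
    have h1 : |p.1.1 x| ≤ ‖x‖ := by
      simpa using p.1.1.le_of_opNorm_le (mem_closedBall_zero_iff.1 p.1.2) x
    have h2 : |p.2.1 y| ≤ ‖y‖ := by
      simpa using p.2.1.le_of_opNorm_le (mem_closedBall_zero_iff.1 p.2.2) y
    rw [dualTensor_tmul, abs_mul]
    exact mul_le_mul h1 h2 (abs_nonneg _) (norm_nonneg _)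
  | add a b ha hb =>
    obtain ⟨C, hC⟩ := ha
    obtain ⟨D, hD⟩ := hb
    refine ⟨C + D, fun p => ?_⟩
    rw [map_add]
    exact (abs_add_le _ _).trans (add_le_add (hC p) (hD p))

/-- Functionals in the two balls separate the points of `X ⊗ Y`. -/
theorem eq_zero_of_dualTensor (u : X ⊗[ℝ] Y)
    (h : ∀ p : DualBalls X Y, dualTensor p.1.1 p.2.1 u = 0) : u = 0 := by
  classical
  have hall : ∀ (f : StrongDual ℝ X) (g : StrongDual ℝ Y), dualTensor f g u = 0 := by
    intro f g
    have hf : (‖f‖ + 1)⁻¹ • f ∈ Metric.closedBall (0 : StrongDual ℝ X) 1 := by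
      rw [mem_closedBall_zero_iff, norm_smul, norm_inv, Real.norm_of_nonneg (by positivity),
        inv_mul_le_iff₀ (by positivity)]
      linarith
    have hg : (‖g‖ + 1)⁻¹ • g ∈ Metric.closedBall (0 : StrongDual ℝ Y) 1 := by
      rw [mem_closedBall_zero_iff, norm_smul, norm_inv, Real.norm_of_nonneg (by positivity),
        inv_mul_le_iff₀ (by positivity)]
      linarith
    have h0 : dualTensor ((‖f‖ + 1)⁻¹ • f) ((‖g‖ + 1)⁻¹ • g) u = 0 :=
      h (⟨_, hf⟩, ⟨_, hg⟩)
    have h1 : dualTensor ((‖f‖ + 1)⁻¹ • f) ((‖g‖ + 1)⁻¹ • g)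
        = (‖f‖ + 1)⁻¹ • ((‖g‖ + 1)⁻¹ • dualTensor f g) := by
      refine TensorProduct.ext' fun x y => ?_
      simp only [LinearMap.smul_apply, dualTensor_tmul, smul_apply,
        smul_eq_mul]
      ring
    have ha : (‖f‖ + 1)⁻¹ ≠ 0 := by positivity
    have hb : (‖g‖ + 1)⁻¹ ≠ 0 := by positivity
    rw [h1, LinearMap.smul_apply, LinearMap.smul_apply, smul_eq_zero_iff_right ha,
      smul_eq_zero_iff_right hb] at h0
    exact h0
  let b := Module.Basis.ofVectorSpace ℝ Y
  let e := TensorProduct.equivFinsuppOfBasisRight (M := X) b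
  have key : ∀ (f : StrongDual ℝ X) (w : X ⊗[ℝ] Y),
      TensorProduct.lid ℝ Y (TensorProduct.map (f : X →ₗ[ℝ] ℝ) LinearMap.id w)
        = Finsupp.linearCombination ℝ b ((e w).mapRange f (map_zero f)) := by
    intro f w
    induction w with
    | zero => simp
    | tmul x y =>
      have : (e (x ⊗ₜ[ℝ] y)).mapRange f (map_zero f) = f x • b.repr y := by
        ext i
        simp [e, mul_comm]
      rw [this, map_smul, Module.Basis.linearCombination_repr]
      simp
    | add a c ha hc =>
      rw [map_add, map_add, ha, hc, ← map_add, map_add e, Finsupp.mapRange_add (map_add f)]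
  have hdt : ∀ (f : StrongDual ℝ X) (g : StrongDual ℝ Y),
      dualTensor f g = (g : Y →ₗ[ℝ] ℝ) ∘ₗ (TensorProduct.lid ℝ Y).toLinearMap ∘ₗ
          TensorProduct.map (f : X →ₗ[ℝ] ℝ) LinearMap.id := by
    intro f g
    refine TensorProduct.ext' fun x y => ?_
    simp [dualTensor_tmul]
  have hcoord : e u = 0 := by
    ext i
    by_contra hne
    obtain ⟨f, hf⟩ := SeparatingDual.exists_ne_zero (R := ℝ) hne
    have hz : TensorProduct.lid ℝ Y
        (TensorProduct.map (f : X →ₗ[ℝ] ℝ) LinearMap.id u) = 0 := by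
      by_contra hy
      obtain ⟨g, hg⟩ := SeparatingDual.exists_ne_zero (R := ℝ) hy
      refine hg ?_
      have := hall f g
      rw [hdt] at this
      exact this
    rw [key] at hz
    have := b.linearIndependent.finsuppLinearCombination_injective (hz.trans (map_zero _).symm)
    exact hf (by simpa using DFunLike.congr_fun this i)
  exact e.injective (hcoord.trans (map_zero e).symm)

variable (X Y)

/-- The algebraic tensor product `X ⊗ Y`, as a type of its own that will carry the injective
norm. -/
def AlgTensor : Type (max u v) := X ⊗[ℝ] Y

instance : AddCommGroup (AlgTensor X Y) := inferInstanceAs (AddCommGroup (X ⊗[ℝ] Y))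

instance : Module ℝ (AlgTensor X Y) := inferInstanceAs (Module ℝ (X ⊗[ℝ] Y))

/-- The identity map between the two names of the algebraic tensor product. -/
def AlgTensor.toTensor : AlgTensor X Y ≃ₗ[ℝ] X ⊗[ℝ] Y := LinearEquiv.refl ℝ (X ⊗[ℝ] Y)

variable {X Y}

/-- The injective norm `‖u‖ = sup {|(f ⊗ g) u| : f ∈ B_{X*}, g ∈ B_{Y*}}`. As the balls are
symmetric, the absolute value does not affect the supremum. -/
instance : Norm (AlgTensor X Y) where
  norm u := ⨆ p : DualBalls X Y, |dualTensor p.1.1 p.2.1 (AlgTensor.toTensor X Y u)|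

theorem norm_def (u : AlgTensor X Y) :
    ‖u‖ = ⨆ p : DualBalls X Y, |dualTensor p.1.1 p.2.1 (AlgTensor.toTensor X Y u)| := rfl

theorem abs_dualTensor_le (u : AlgTensor X Y) (p : DualBalls X Y) :
    |dualTensor p.1.1 p.2.1 (AlgTensor.toTensor X Y u)| ≤ ‖u‖ :=
  le_ciSup (bddAbove_dualTensor (AlgTensor.toTensor X Y u)) p

theorem injectiveCore : NormedSpace.Core ℝ (AlgTensor X Y) where
  norm_nonneg u := Real.iSup_nonneg fun _ => abs_nonneg _
  norm_smul c u := by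
    simp only [norm_def, map_smul, smul_eq_mul, abs_mul, Real.norm_eq_abs]
    rw [Real.mul_iSup_of_nonneg (abs_nonneg c)]
  norm_triangle u w := by
    rw [norm_def (u + w)]
    refine ciSup_le fun p => ?_
    rw [map_add, map_add]
    exact (abs_add_le _ _).trans (add_le_add (abs_dualTensor_le u p) (abs_dualTensor_le w p))
  norm_eq_zero_iff u := by
    constructor
    · intro h
      refine (AlgTensor.toTensor X Y).map_eq_zero_iff.1 (eq_zero_of_dualTensor _ fun p => ?_)
      exact abs_eq_zero.1 (le_antisymm (h ▸ abs_dualTensor_le u p) (abs_nonneg _))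
    · rintro rfl
      simp [norm_def]

instance : NormedAddCommGroup (AlgTensor X Y) := NormedAddCommGroup.ofCore injectiveCore

instance : NormedSpace ℝ (AlgTensor X Y) := NormedSpace.ofCore injectiveCore

variable (X Y)

/-- The injective tensor product: the completion of `X ⊗ Y` in the injective norm. -/
abbrev InjectiveTensorProduct : Type (max u v) := UniformSpace.Completion (AlgTensor X Y)

end InjectiveTensor

/-! ### Boundaries, `w*`-LRC sets, smooth and approximating norms -/

section Notions

variable {X : Type u} [NormedAddCommGroup X] [NormedSpace ℝ X]

/-- `B ⊆ B_{X*}` is a boundary of `X` if every point of the unit sphere of `X` is normed by an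
element of `B`. -/
def IsBoundary (B : Set (StrongDual ℝ X)) : Prop :=
  B ⊆ Metric.closedBall 0 1 ∧ ∀ x ∈ Metric.sphere (0 : X) 1, ∃ f ∈ B, f x = 1

/-- `w*`-locally relatively compact sets: every point of `E` has a `w*`-open neighbourhood `U`
such that the norm closure of `E ∩ U` is norm compact. -/
def IsWeakStarLRC (E : Set (StrongDual ℝ X)) : Prop :=
  ∀ y ∈ E, ∃ U : Set (WeakDual ℝ X), IsOpen U ∧ StrongDual.toWeakDual y ∈ U ∧
    IsCompact (closure (E ∩ StrongDual.toWeakDual ⁻¹' U))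

/-- A countable union of `w*`-compact subsets of the dual. -/
def IsSigmaWeakStarCompact (E : Set (StrongDual ℝ X)) : Prop :=
  IsSigmaCompact (StrongDual.toWeakDual '' E : Set (WeakDual ℝ X))

/-- The function `p` (a norm on `X`) is `C^k` smooth away from the origin. -/
def IsSmoothNorm (k : ℕ∞) (p : X → ℝ) : Prop :=
  ContDiffOn ℝ (k : WithTop ℕ∞) p {0}ᶜ

/-- `p` is an equivalent norm on `X`. -/
def IsEquivalentNorm (p : Seminorm ℝ X) : Prop :=
  ∃ c C : ℝ, 0 < c ∧ 0 < C ∧ ∀ x, c * ‖x‖ ≤ p x ∧ p x ≤ C * ‖x‖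

/-- `p` `ε`-approximates the given norm of `X`. -/
def Approximates (ε : ℝ) (p : Seminorm ℝ X) : Prop :=
  ∀ x, (1 - ε) * ‖x‖ ≤ p x ∧ p x ≤ (1 + ε) * ‖x‖

end Notions

end SmoothRenorm

end

namespace SmoothRenorm

open Filter Topology Set

/-! ### A smooth convex cutoff -/

/-! The injective norm of `u` is the maximum of `‖slice f u‖` over the dual ball, and it is already
attained on any boundary of `X`: if `g` norms an optimal slice, then `sliceRight g u` is a vector of
`X` of norm `‖u‖`, and the boundary norms it (`IsBoundary.exists_norm_slice_eq`). Each `u ↦ ‖slice f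
u‖` is smooth off its kernel because the norm of `Y` is. It remains to perturb this supremum so that
near each point only finitely many slices matter.

The perturbation multiplies slices by weights close to `1`. The part of `E` in the dual ball is
covered by `w*`-closed sets `C j` with `w*`-closed parts `D j` such that `C j \ D j` is `w*`-LRC
(`exists_isLRCFamily`). The weight gains `e j` whenever points off `C j`, or off `D j`, converge
`w*` to a point of that set (`exists_tendsto_weight`). The functionals are restricted to separated
nets of the levels; the extra factor `e j / 8` pays for this restriction. If infinitely many net
points were almost maximal at `u`, take a `w*`-limit `f` along an ultrafilter. Either the weight
jumps at `f`, and the weighted slice at `f` is too large, or the points leave every `C j` and their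
weights tend to `1`, while the norm of `u` is attained at a point of weight greater than `1`
(`exists_finset_sliceSeminorm_le`).

Finally, the sum of smooth convex cutoffs of the weighted slices is locally finite. Its sublevel set
at `1` is a convex body whose gauge is smooth by the implicit function theorem
(`exists_smooth_seminorm`). -/

/-- A smooth convex increasing function that vanishes on `(-∞, 0]` and takes the value `1` at `1`. -/
noncomputable def convexCutoff (t : ℝ) : ℝ := Real.exp 1 * (t * expNegInvGlue t)

theorem contDiff_convexCutoff {n : ℕ∞} : ContDiff ℝ n convexCutoff :=
  contDiff_const.mul (contDiff_id.mul expNegInvGlue.contDiff)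

theorem convexCutoff_of_nonpos {t : ℝ} (ht : t ≤ 0) : convexCutoff t = 0 := by
  simp [convexCutoff, expNegInvGlue.zero_of_nonpos ht]

theorem convexCutoff_nonneg (t : ℝ) : 0 ≤ convexCutoff t := by
  rcases le_total t 0 with ht | ht
  · rw [convexCutoff_of_nonpos ht]
  · exact mul_nonneg (Real.exp_pos _).le (mul_nonneg ht (expNegInvGlue.nonneg t))

theorem monotone_convexCutoff : Monotone convexCutoff := by
  intro s t hst
  rcases le_total s 0 with hs | hs
  · rw [convexCutoff_of_nonpos hs]
    exact convexCutoff_nonneg t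
  · exact mul_le_mul_of_nonneg_left (mul_le_mul hst (expNegInvGlue.monotone hst)
      (expNegInvGlue.nonneg s) (hs.trans hst)) (Real.exp_pos _).le

theorem one_lt_convexCutoff {t : ℝ} (ht : 1 < t) : 1 < convexCutoff t := by
  have h0 : 0 < t := zero_lt_one.trans ht
  have h1 : t⁻¹ ≤ 1 := inv_le_one_of_one_le₀ ht.le
  rw [convexCutoff, expNegInvGlue, if_neg h0.not_ge, mul_left_comm, ← Real.exp_add]
  have : 1 ≤ Real.exp (1 + -t⁻¹) := Real.one_le_exp (by linarith)
  nlinarith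

/-- The tangent line of `t ↦ t * exp (-1 / t)` at `t₀ > 0` lies below the graph. -/
theorem tangent_le_mul_expNegInvGlue {t₀ : ℝ} (h₀ : 0 < t₀) (t : ℝ) :
    Real.exp (-t₀⁻¹) * ((1 + t₀⁻¹) * t - 1) ≤ t * expNegInvGlue t := by
  have hs : 0 < t₀⁻¹ := inv_pos.2 h₀
  have he := Real.exp_pos (-t₀⁻¹)
  rcases le_or_gt t 0 with ht | ht
  · rw [expNegInvGlue.zero_of_nonpos ht, mul_zero]
    exact mul_nonpos_of_nonneg_of_nonpos he.le (by nlinarith)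
  · rw [expNegInvGlue, if_neg ht.not_ge]
    -- With `exp (-t₀⁻¹)` factored out, the tangent inequality is `x + 1 ≤ exp x` at `x = t₀⁻¹ -
    -- t⁻¹`.
    have h1 : t₀⁻¹ - t⁻¹ + 1 ≤ Real.exp (t₀⁻¹ - t⁻¹) := Real.add_one_le_exp _
    have h2 : Real.exp (-t⁻¹) = Real.exp (-t₀⁻¹) * Real.exp (t₀⁻¹ - t⁻¹) := by
      rw [← Real.exp_add]
      congr 1
      ring
    have h3 : (1 + t₀⁻¹) * t - 1 = t * (t₀⁻¹ - t⁻¹ + 1) := by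
      field_simp
      ring
    rw [h2, h3]
    calc Real.exp (-t₀⁻¹) * (t * (t₀⁻¹ - t⁻¹ + 1))
        = t * (Real.exp (-t₀⁻¹) * (t₀⁻¹ - t⁻¹ + 1)) := by ring
      _ ≤ _ := by gcongr

/-- At a positive argument the graph has a global supporting line; at a nonpositive one the function
takes its minimum `0`. This avoids second derivatives. -/
theorem convexOn_convexCutoff : ConvexOn ℝ univ convexCutoff := by
  refine ⟨convex_univ, fun x _ y _ a b ha hb hab => ?_⟩
  simp only [smul_eq_mul]
  rcases le_or_gt (a * x + b * y) 0 with hz | hz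
  · rw [convexCutoff_of_nonpos hz]
    exact add_nonneg (mul_nonneg ha (convexCutoff_nonneg x)) (mul_nonneg hb (convexCutoff_nonneg y))
  · set z := a * x + b * y with hzdef
    have hx := tangent_le_mul_expNegInvGlue hz x
    have hy := tangent_le_mul_expNegInvGlue hz y
    have hval : z * expNegInvGlue z = Real.exp (-z⁻¹) * ((1 + z⁻¹) * z - 1) := by
      rw [expNegInvGlue, if_neg hz.not_ge]
      field_simp
      ring
    have key : z * expNegInvGlue z ≤ a * (x * expNegInvGlue x) + b * (y * expNegInvGlue y) := by
      have h1 := mul_le_mul_of_nonneg_left hx ha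
      have h2 := mul_le_mul_of_nonneg_left hy hb
      have h3 : Real.exp (-z⁻¹) * ((1 + z⁻¹) * z - 1)
          = a * (Real.exp (-z⁻¹) * ((1 + z⁻¹) * x - 1))
            + b * (Real.exp (-z⁻¹) * ((1 + z⁻¹) * y - 1)) := by
        have hb' : b = 1 - a := by linarith
        generalize Real.exp (-z⁻¹) = e
        generalize z⁻¹ = w
        rw [hzdef, hb']
        ring
      linarith
    have := mul_le_mul_of_nonneg_left key (Real.exp_pos 1).le
    simp only [convexCutoff]
    linarith

/-! ### Smoothing a locally finite supremum of smooth seminorms -/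

section Smoothing

variable {Z : Type*} [NormedAddCommGroup Z] [NormedSpace ℝ Z]

/-- The function `u ↦ θ ((q u - (1 - τ)) / τ)`, where `θ` is the convex cutoff. -/
noncomputable def cutoffSeminorm (q : Seminorm ℝ Z) (τ : ℝ) (u : Z) : ℝ :=
  convexCutoff ((q u - (1 - τ)) / τ)

variable {q : Seminorm ℝ Z} {τ : ℝ}

theorem cutoffSeminorm_nonneg (u : Z) : 0 ≤ cutoffSeminorm q τ u := convexCutoff_nonneg _

theorem cutoffSeminorm_eq_zero (hτ : 0 < τ) {u : Z} (hu : q u ≤ 1 - τ) :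
    cutoffSeminorm q τ u = 0 :=
  convexCutoff_of_nonpos (div_nonpos_of_nonpos_of_nonneg (by linarith) hτ.le)

theorem cutoffSeminorm_mono (hτ : 0 < τ) {u v : Z} (h : q u ≤ q v) :
    cutoffSeminorm q τ u ≤ cutoffSeminorm q τ v :=
  monotone_convexCutoff (by gcongr)

theorem le_one_of_cutoffSeminorm_le_one (hτ : 0 < τ) {u : Z} (h : cutoffSeminorm q τ u ≤ 1) :
    q u ≤ 1 := by
  by_contra! hu
  refine h.not_gt (one_lt_convexCutoff ?_)
  rw [one_lt_div hτ]
  linarith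

theorem convexOn_cutoffSeminorm (hτ : 0 < τ) : ConvexOn ℝ univ (cutoffSeminorm q τ) := by
  refine ⟨convex_univ, fun x _ y _ a b ha hb hab => ?_⟩
  refine le_trans ?_ (convexOn_convexCutoff.2 (mem_univ _) (mem_univ _) ha hb hab)
  refine monotone_convexCutoff ?_
  have h1 : q (a • x + b • y) ≤ a * q x + b * q y := by
    refine (map_add_le_add q _ _).trans ?_
    rw [map_smul_eq_mul, map_smul_eq_mul, Real.norm_of_nonneg ha, Real.norm_of_nonneg hb]
  have h2 : a • ((q x - (1 - τ)) / τ) + b • ((q y - (1 - τ)) / τ)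
      = (a * q x + b * q y - (1 - τ)) / τ := by
    simp only [smul_eq_mul]
    have hb' : b = 1 - a := by linarith
    rw [hb']
    field_simp
    ring
  rw [h2]
  gcongr

/-- The seminorm may fail to be smooth on its kernel, but near the kernel it stays below `1 - τ`,
where the cutoff vanishes. -/
theorem contDiff_cutoffSeminorm {n : ℕ∞} (hτ : 0 < τ) (hτ1 : τ < 1) (hq : Continuous q)
    (hn : ∀ u, q u ≠ 0 → ContDiffAt ℝ n q u) : ContDiff ℝ n (cutoffSeminorm q τ) := by
  rw [contDiff_iff_contDiffAt]
  intro u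
  by_cases hu : q u = 0
  · have hlt : ∀ᶠ v in 𝓝 u, q v < 1 - τ := hq.continuousAt.eventually_lt_const (by linarith)
    refine (contDiffAt_const (c := (0 : ℝ))).congr_of_eventuallyEq ?_
    filter_upwards [hlt] with v hv
    exact cutoffSeminorm_eq_zero hτ hv.le
  · exact contDiff_convexCutoff.contDiffAt.comp u (((hn u hu).sub contDiffAt_const).div_const τ)

end Smoothing

section Gauge

variable {Z : Type*} [NormedAddCommGroup Z] [NormedSpace ℝ Z]

/-- If near `u` the gauge of `B` is determined by the equation `Φ = 1`, with `Φ` convex and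
smooth, then the gauge is smooth at `u`. -/
theorem contDiffAt_of_level_set [CompleteSpace Z] {n : ℕ∞} (hn : n ≠ 0) (p : Seminorm ℝ Z)
    {Φ : Z → ℝ} (hΦ : ContDiff ℝ n Φ) (hconv : ConvexOn ℝ univ Φ) (h0 : Φ 0 = 0) {u : Z}
    (hu : Φ u = 1) (hloc : ∀ᶠ v in 𝓝 u, Φ v = 1 → p v = 1) : ContDiffAt ℝ n p u := by
  have hn' : (n : WithTop ℕ∞) ≠ 0 := by exact_mod_cast hn
  let G : Z × ℝ → ℝ := fun w => Φ (w.2 • w.1)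
  have hG : ContDiff ℝ n G := hΦ.comp (contDiff_snd.smul contDiff_fst)
  have hGat : ContDiffAt ℝ n G (u, 1) := hG.contDiffAt
  have hdiff : DifferentiableAt ℝ G (u, 1) := hGat.differentiableAt hn'
  have hΦd : DifferentiableAt ℝ Φ u := hΦ.contDiffAt.differentiableAt hn'
  -- the derivative in the scalar variable is at least `Φ u - Φ 0 = 1`
  let g : ℝ → ℝ := fun t => Φ (t • u)
  have hg : ConvexOn ℝ univ g := by
    have := hconv.comp_linearMap (LinearMap.toSpanSingleton ℝ Z u)
    simpa [g, Function.comp_def] using this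
  have hgd : HasDerivAt g (fderiv ℝ G (u, 1) (0, 1)) 1 := by
    have h1 : HasDerivAt (fun t : ℝ => (u, t)) ((0 : Z), (1 : ℝ)) 1 :=
      (hasDerivAt_const _ _).prodMk (hasDerivAt_id _)
    exact hdiff.hasFDerivAt.comp_hasDerivAt (1 : ℝ) h1
  have hpos : 1 ≤ fderiv ℝ G (u, 1) (0, 1) := by
    have := hg.slope_le_of_hasDerivAt (mem_univ (0 : ℝ)) (mem_univ (1 : ℝ)) zero_lt_one hgd
    simpa [slope_def_field, g, h0, hu] using this
  -- A nonzero derivative in the scalar variable is an invertible map of `ℝ`, so `Φ (t • v) = 1` can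
  -- be solved for `t = φ v` near `u`; homogeneity then gives `p v = (φ v)⁻¹`.
  have hinv : (fderiv ℝ G (u, 1) ∘L .inr ℝ Z ℝ).IsInvertible := by
    have hne : fderiv ℝ G (u, 1) (0, 1) ≠ 0 := by linarith
    refine ⟨ContinuousLinearEquiv.unitsEquivAut ℝ (Units.mk0 _ hne), ?_⟩
    ext
    simp
  let φ := hGat.implicitFunction hn' hinv
  have hφ : ContDiffAt ℝ n φ u := hGat.contDiffAt_implicitFunction hn' hinv
  have hφu : φ u = 1 := hGat.implicitFunction_apply_self hn' hinv
  have hφeq : ∀ᶠ v in 𝓝 u, Φ (φ v • v) = 1 := by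
    have := hGat.eventually_apply_implicitFunction hn' hinv
    simpa [G, hu] using this
  have hφpos : ∀ᶠ v in 𝓝 u, 0 < φ v :=
    hφ.continuousAt.eventually_const_lt (by rw [hφu]; exact zero_lt_one)
  have htend : Tendsto (fun v => φ v • v) (𝓝 u) (𝓝 u) := by
    have : ContinuousAt (fun v => φ v • v) u := hφ.continuousAt.smul continuousAt_id
    simpa [ContinuousAt, hφu] using this
  refine (hφ.inv (by rw [hφu]; exact one_ne_zero)).congr_of_eventuallyEq ?_
  filter_upwards [hφeq, hφpos, htend.eventually hloc] with v h1 h2 h3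
  have := h3 h1
  rw [map_smul_eq_mul, Real.norm_of_nonneg h2.le] at this
  exact eq_inv_of_mul_eq_one_right this

/-- Suppose that the seminorms `q i` are uniformly bounded and smooth off their kernels, that their
supremum dominates the norm, and that near every `u ≠ 0` in their common unit ball only finitely
many of them come close to `1`, in the sense measured by the thresholds `1 - τ i`. Then there is
a smooth norm that is squeezed between the given norm and a multiple of it. -/
theorem exists_smooth_seminorm [CompleteSpace Z] {ι : Type*} (q : ι → Seminorm ℝ Z) (τ : ι → ℝ)
    {c τ₀ : ℝ} {n : ℕ∞} (hn : n ≠ 0) (hc : 0 < c) (hqc : ∀ i u, q i u ≤ c * ‖u‖)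
    (hτ : ∀ i, 0 < τ i) (hτ₀ : ∀ i, τ i ≤ τ₀) (hτ1 : τ₀ < 1)
    (hsmooth : ∀ i u, q i u ≠ 0 → ContDiffAt ℝ n (q i) u)
    (hlow : ∀ u, (∀ i, q i u ≤ 1) → ‖u‖ ≤ 1)
    (hfin : ∀ u, u ≠ 0 → (∀ i, q i u ≤ 1) →
      ∃ S : Finset ι, ∃ η > 0, ∀ i ∉ S, q i u ≤ 1 - τ i - η) :
    ∃ p : Seminorm ℝ Z, (∀ u, ‖u‖ ≤ p u ∧ p u ≤ c / (1 - τ₀) * ‖u‖) ∧ IsSmoothNorm n p := by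
  classical
  have hτlt : ∀ i, τ i < 1 := fun i => (hτ₀ i).trans_lt hτ1
  have hqcont : ∀ i, Continuous (q i) := by
    intro i
    lift c to NNReal using hc.le
    refine Seminorm.continuous_of_le (q := c • normSeminorm ℝ Z) ?_ ?_
    · exact continuous_const.mul continuous_norm
    · exact fun u => hqc i u
  let F : Finset ι → Z → ℝ := fun S u => ∑ i ∈ S, cutoffSeminorm (q i) (τ i) u
  have hFcd : ∀ S, ContDiff ℝ n (F S) := fun S => ContDiff.sum fun i _ =>
    contDiff_cutoffSeminorm (hτ i) (hτlt i) (hqcont i) (hsmooth i)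
  have hFconv : ∀ S, ConvexOn ℝ univ (F S) := fun S => by
    induction S using Finset.induction_on with
    | empty => simpa [F] using convexOn_const (0 : ℝ) convex_univ
    | insert i S hi ih =>
      have := (convexOn_cutoffSeminorm (q := q i) (hτ i)).add ih
      refine this.congr fun u _ => ?_
      simp [F, Finset.sum_insert hi]
  have hF0 : ∀ S, F S 0 = 0 := fun S => Finset.sum_eq_zero fun i _ =>
    cutoffSeminorm_eq_zero (hτ i) (by rw [map_zero]; linarith [hτlt i])
  -- Bounding all finite partial sums defines the unit ball without asking for summability.
  let B : Set Z := {u | ∀ S, F S u ≤ 1}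
  have hBconv : Convex ℝ B := by
    have : B = ⋂ S, {u | F S u ≤ 1} := by ext; simp [B]
    rw [this]
    exact convex_iInter fun S => by simpa using (hFconv S).convex_le 1
  have hBclosed : IsClosed B := by
    have : B = ⋂ S, {u | F S u ≤ 1} := by ext; simp [B]
    rw [this]
    exact isClosed_iInter fun S => isClosed_le (hFcd S).continuous continuous_const
  have hBbal : Balanced ℝ B := by
    rintro a ha _ ⟨u, hu, rfl⟩ S
    refine le_trans (Finset.sum_le_sum fun i _ => cutoffSeminorm_mono (hτ i) ?_) (hu S)
    change q i (a • u) ≤ q i u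
    rw [map_smul_eq_mul]
    exact mul_le_of_le_one_left (apply_nonneg _ _) ha
  have hr : 0 < (1 - τ₀) / c := div_pos (by linarith) hc
  -- On this ball every `q i` is below `1 - τ₀`, so all cutoffs vanish. Its radius yields the upper
  -- constant `c / (1 - τ₀)`.
  have hball : Metric.ball (0 : Z) ((1 - τ₀) / c) ⊆ B := by
    intro u hu S
    rw [mem_ball_zero_iff, lt_div_iff₀ hc] at hu
    refine le_of_eq_of_le (Finset.sum_eq_zero fun i _ => cutoffSeminorm_eq_zero (hτ i) ?_)
      zero_le_one
    have := hqc i u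
    linarith [hτ₀ i]
  have hB0 : B ∈ 𝓝 (0 : Z) := mem_of_superset (Metric.ball_mem_nhds _ hr) hball
  have hBabs : Absorbent ℝ B := absorbent_nhds_zero hB0
  have hBq : ∀ u ∈ B, ∀ i, q i u ≤ 1 := fun u hu i =>
    le_one_of_cutoffSeminorm_le_one (hτ i) (by simpa [F] using hu {i})
  have hBle : B ⊆ Metric.closedBall 0 1 := fun u hu => by
    rw [mem_closedBall_zero_iff]
    exact hlow u (hBq u hu)
  let p : Seminorm ℝ Z := gaugeSeminorm hBbal hBconv hBabs
  have hp : ∀ u, p u = gauge B u := fun u => rfl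
  have hpB : ∀ u, p u ≤ 1 ↔ u ∈ B := fun u => by
    rw [hp, gauge_le_one_iff_mem_closure hBconv hB0, hBclosed.closure_eq]
  have hnorm : ∀ u, ‖u‖ ≤ p u := fun u => by
    simpa [hp] using le_gauge_of_subset_closedBall hBabs zero_le_one hBle (x := u)
  refine ⟨p, fun u => ⟨hnorm u, ?_⟩, ?_⟩
  · have := mul_gauge_le_norm (x := u) hball
    rw [← hp] at this
    have hc' : c / (1 - τ₀) = ((1 - τ₀) / c)⁻¹ := by rw [inv_div]
    rw [hc', ← div_eq_inv_mul, le_div_iff₀ hr, mul_comm]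
    exact this
  -- smoothness at points of the unit sphere
  have hsph : ∀ u, p u = 1 → ContDiffAt ℝ n p u := by
    intro u hu
    have hu0 : u ≠ 0 := by
      rintro rfl
      simp at hu
    have huB : u ∈ B := (hpB u).1 hu.le
    obtain ⟨S, η, hη, hS⟩ := hfin u hu0 (hBq u huB)
    have hnear : ∀ᶠ v in 𝓝 u, ∀ i ∉ S, cutoffSeminorm (q i) (τ i) v = 0 := by
      filter_upwards [Metric.ball_mem_nhds u (div_pos hη hc)] with v hv i hi
      refine cutoffSeminorm_eq_zero (hτ i) ?_
      rw [mem_ball_iff_norm, lt_div_iff₀ hc] at hv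
      have h1 : q i v ≤ q i u + q i (v - u) := by
        simpa using map_add_le_add (q i) u (v - u)
      linarith [hqc i (v - u), hS i hi]
    have hnearB : ∀ᶠ v in 𝓝 u, F S v ≤ 1 → v ∈ B := by
      filter_upwards [hnear] with v hv hle S'
      calc F S' v = ∑ i ∈ S' ∩ S, cutoffSeminorm (q i) (τ i) v := by
            refine (Finset.sum_subset Finset.inter_subset_left fun i hi hi' => hv i ?_).symm
            exact fun h => hi' (Finset.mem_inter.2 ⟨hi, h⟩)
        _ ≤ F S v := Finset.sum_le_sum_of_subset_of_nonneg Finset.inter_subset_right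
            fun i _ _ => cutoffSeminorm_nonneg v
        _ ≤ 1 := hle
    -- If the local sum were below `1`, a neighbourhood of `u` would lie in `B` and the gauge at `u`
    -- would be less than `1`.
    have huS : F S u = 1 := by
      refine le_antisymm (huB S) ?_
      by_contra! hlt
      have h1 : ∀ᶠ v in 𝓝 u, v ∈ B := by
        filter_upwards [hnearB, (hFcd S).continuous.continuousAt.eventually_lt_const hlt]
          with v h1 h2 using h1 h2.le
      have : gauge B u < 1 :=
        (gauge_lt_one_iff_mem_interior hBconv hB0).2 (mem_interior_iff_mem_nhds.2 h1)
      exact this.ne hu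
    refine contDiffAt_of_level_set hn p (hFcd S) (hFconv S) (hF0 S) huS ?_
    filter_upwards [hnearB] with v hv h1
    refine le_antisymm ((hpB v).2 (hv h1.le)) ?_
    by_contra! hlt
    have hv0 : v ≠ 0 := by
      rintro rfl
      rw [hF0 S] at h1
      exact zero_ne_one h1
    have hpos : 0 < p v := (norm_pos_iff.2 hv0).trans_le (hnorm v)
    have hmem : (p v)⁻¹ • v ∈ B := by
      rw [← hpB, map_smul_eq_mul, norm_inv, Real.norm_of_nonneg hpos.le, inv_mul_cancel₀ hpos.ne']
    -- If `p v < 1`, convexity on the segment from `0` to `(p v)⁻¹ • v`, a point of `B`, gives `F S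
    -- v ≤ p v < 1`, against `F S v = 1`.
    have hcv := (hFconv S).2 (mem_univ ((p v)⁻¹ • v)) (mem_univ 0) hpos.le
      (sub_nonneg.2 hlt.le) (by ring)
    rw [smul_zero, add_zero, smul_inv_smul₀ hpos.ne', h1, hF0 S, smul_zero, add_zero,
      smul_eq_mul] at hcv
    have := mul_le_mul_of_nonneg_left (hmem S) hpos.le
    linarith
  intro u hu
  have hu0 : u ≠ 0 := hu
  have hpos : 0 < p u := (norm_pos_iff.2 hu0).trans_le (hnorm u)
  refine ContDiffAt.contDiffWithinAt ?_
  have h1 : ContDiffAt ℝ n p ((p u)⁻¹ • u) := hsph _ (by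
    rw [map_smul_eq_mul, norm_inv, Real.norm_of_nonneg hpos.le, inv_mul_cancel₀ hpos.ne'])
  -- Homogeneity carries smoothness from the unit sphere to `u`.
  have h2 : ContDiffAt ℝ n (fun v => p u * p ((p u)⁻¹ • v)) u :=
    contDiffAt_const.mul (h1.comp u (contDiffAt_id.const_smul _))
  refine h2.congr_of_eventuallyEq (Eventually.of_forall fun v => ?_)
  change p v = p u * p ((p u)⁻¹ • v)
  rw [map_smul_eq_mul, norm_inv, Real.norm_of_nonneg hpos.le, mul_inv_cancel_left₀ hpos.ne']

end Gauge

/-! ### Slices of elements of the injective tensor product -/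

section Slices

variable {X Y : Type*} [NormedAddCommGroup X] [NormedSpace ℝ X]
  [NormedAddCommGroup Y] [NormedSpace ℝ Y]

theorem dualTensor_smul_smul (a b : ℝ) (f : StrongDual ℝ X) (g : StrongDual ℝ Y) :
    dualTensor (a • f) (b • g) = (a * b) • dualTensor f g := by
  refine TensorProduct.ext' fun x y => ?_
  simp only [LinearMap.smul_apply, dualTensor_tmul, smul_apply, smul_eq_mul]
  ring

theorem abs_dualTensor_le_mul (f : StrongDual ℝ X) (g : StrongDual ℝ Y) (w : AlgTensor X Y) :
    |dualTensor f g (AlgTensor.toTensor X Y w)| ≤ ‖f‖ * ‖g‖ * ‖w‖ := by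
  have hf : ‖f‖⁻¹ • f ∈ Metric.closedBall (0 : StrongDual ℝ X) 1 := by
    rw [mem_closedBall_zero_iff, norm_smul, norm_inv, norm_norm]
    exact inv_mul_le_one
  have hg : ‖g‖⁻¹ • g ∈ Metric.closedBall (0 : StrongDual ℝ Y) 1 := by
    rw [mem_closedBall_zero_iff, norm_smul, norm_inv, norm_norm]
    exact inv_mul_le_one
  have h := abs_dualTensor_le w (⟨_, hf⟩, ⟨_, hg⟩)
  have hf' : f = ‖f‖ • (‖f‖⁻¹ • f) := by
    by_cases h0 : f = 0
    · simp [h0]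
    · rw [smul_inv_smul₀ (norm_ne_zero_iff.2 h0)]
  have hg' : g = ‖g‖ • (‖g‖⁻¹ • g) := by
    by_cases h0 : g = 0
    · simp [h0]
    · rw [smul_inv_smul₀ (norm_ne_zero_iff.2 h0)]
  calc |dualTensor f g (AlgTensor.toTensor X Y w)|
      = ‖f‖ * ‖g‖ * |dualTensor (‖f‖⁻¹ • f) (‖g‖⁻¹ • g) (AlgTensor.toTensor X Y w)| := by
        conv_lhs => rw [hf', hg', dualTensor_smul_smul, LinearMap.smul_apply, smul_eq_mul, abs_mul,
          abs_of_nonneg (mul_nonneg (norm_nonneg f) (norm_nonneg g))]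
    _ ≤ ‖f‖ * ‖g‖ * ‖w‖ := by gcongr

/-- The map `f ⊗ id : X ⊗ Y → Y`. -/
noncomputable def algSlice (f : StrongDual ℝ X) : AlgTensor X Y →ₗ[ℝ] Y :=
  (TensorProduct.lid ℝ Y).toLinearMap ∘ₗ TensorProduct.map (f : X →ₗ[ℝ] ℝ) LinearMap.id ∘ₗ
    (AlgTensor.toTensor X Y).toLinearMap

/-- The map `id ⊗ g : X ⊗ Y → X`. -/
noncomputable def algSliceRight (g : StrongDual ℝ Y) : AlgTensor X Y →ₗ[ℝ] X :=
  (TensorProduct.rid ℝ X).toLinearMap ∘ₗ TensorProduct.map LinearMap.id (g : Y →ₗ[ℝ] ℝ) ∘ₗ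
    (AlgTensor.toTensor X Y).toLinearMap

theorem algSlice_symm_tmul (f : StrongDual ℝ X) (x : X) (y : Y) :
    algSlice f ((AlgTensor.toTensor X Y).symm (x ⊗ₜ[ℝ] y)) = f x • y := by
  simp [algSlice]

theorem apply_algSlice (f : StrongDual ℝ X) (g : StrongDual ℝ Y) (w : AlgTensor X Y) :
    g (algSlice f w) = dualTensor f g (AlgTensor.toTensor X Y w) := by
  have : (g : Y →ₗ[ℝ] ℝ) ∘ₗ (TensorProduct.lid ℝ Y).toLinearMap ∘ₗ
      TensorProduct.map (f : X →ₗ[ℝ] ℝ) LinearMap.id = dualTensor f g :=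
    TensorProduct.ext' fun x y => by simp [dualTensor_tmul]
  rw [← this]
  rfl

theorem apply_algSliceRight (f : StrongDual ℝ X) (g : StrongDual ℝ Y) (w : AlgTensor X Y) :
    f (algSliceRight g w) = dualTensor f g (AlgTensor.toTensor X Y w) := by
  have : (f : X →ₗ[ℝ] ℝ) ∘ₗ (TensorProduct.rid ℝ X).toLinearMap ∘ₗ
      TensorProduct.map LinearMap.id (g : Y →ₗ[ℝ] ℝ) = dualTensor f g :=
    TensorProduct.ext' fun x y => by simp [dualTensor_tmul, mul_comm]
  rw [← this]
  rfl

theorem norm_algSlice_le (f : StrongDual ℝ X) (w : AlgTensor X Y) :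
    ‖algSlice f w‖ ≤ ‖f‖ * ‖w‖ := by
  refine NormedSpace.norm_le_dual_bound ℝ _ (by positivity) fun g => ?_
  rw [apply_algSlice, Real.norm_eq_abs]
  exact (abs_dualTensor_le_mul f g w).trans_eq (by ring)

theorem norm_algSliceRight_le (g : StrongDual ℝ Y) (w : AlgTensor X Y) :
    ‖algSliceRight g w‖ ≤ ‖g‖ * ‖w‖ := by
  refine NormedSpace.norm_le_dual_bound ℝ _ (by positivity) fun f => ?_
  rw [apply_algSliceRight, Real.norm_eq_abs]
  exact (abs_dualTensor_le_mul f g w).trans_eq (by ring)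

/-- The map `f ⊗ id` on the injective tensor product. -/
noncomputable def slice [CompleteSpace Y] (f : StrongDual ℝ X) : InjectiveTensorProduct X Y →L[ℝ] Y :=
  ((algSlice f).mkContinuous ‖f‖ (norm_algSlice_le f)).extend UniformSpace.Completion.toComplL

/-- The map `id ⊗ g` on the injective tensor product. -/
noncomputable def sliceRight [CompleteSpace X] (g : StrongDual ℝ Y) : InjectiveTensorProduct X Y →L[ℝ] X :=
  ((algSliceRight g).mkContinuous ‖g‖ (norm_algSliceRight_le g)).extend UniformSpace.Completion.toComplL

theorem slice_coe [CompleteSpace Y] (f : StrongDual ℝ X) (w : AlgTensor X Y) :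
    slice f (w : InjectiveTensorProduct X Y) = algSlice f w :=
  ContinuousLinearMap.extend_eq (e := UniformSpace.Completion.toComplL)
    ((algSlice f).mkContinuous ‖f‖ (norm_algSlice_le f)) UniformSpace.Completion.denseRange_coe
    (UniformSpace.Completion.isUniformInducing_coe _) w

theorem sliceRight_coe [CompleteSpace X] (g : StrongDual ℝ Y) (w : AlgTensor X Y) :
    sliceRight g (w : InjectiveTensorProduct X Y) = algSliceRight g w :=
  ContinuousLinearMap.extend_eq (e := UniformSpace.Completion.toComplL)
    ((algSliceRight g).mkContinuous ‖g‖ (norm_algSliceRight_le g)) UniformSpace.Completion.denseRange_coe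
    (UniformSpace.Completion.isUniformInducing_coe _) w

variable [CompleteSpace Y]

theorem norm_slice_le (f : StrongDual ℝ X) (u : InjectiveTensorProduct X Y) :
    ‖slice f u‖ ≤ ‖f‖ * ‖u‖ := by
  induction u using UniformSpace.Completion.induction_on with
  | hp => exact isClosed_le (slice f).continuous.norm (continuous_const.mul continuous_norm)
  | ih w =>
    rw [slice_coe, UniformSpace.Completion.norm_coe]
    exact norm_algSlice_le f w

theorem norm_slice_le_norm {f : StrongDual ℝ X} (hf : ‖f‖ ≤ 1) (u : InjectiveTensorProduct X Y) :
    ‖slice f u‖ ≤ ‖u‖ :=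
  (norm_slice_le f u).trans (mul_le_of_le_one_left (norm_nonneg u) hf)

theorem slice_sub (f f' : StrongDual ℝ X) (u : InjectiveTensorProduct X Y) :
    slice (f - f') u = slice f u - slice f' u := by
  induction u using UniformSpace.Completion.induction_on with
  | hp =>
    exact isClosed_eq (slice (f - f')).continuous ((slice f).continuous.sub (slice f').continuous)
  | ih w =>
    simp only [slice_coe]
    obtain ⟨t, rfl⟩ := (AlgTensor.toTensor X Y).symm.surjective w
    induction t with
    | zero => simp
    | tmul x y => simp [algSlice_symm_tmul, sub_smul]
    | add a b ha hb =>
      rw [map_add, map_add, map_add, map_add, ha, hb]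
      abel

theorem abs_norm_slice_sub_le (f f' : StrongDual ℝ X) (u : InjectiveTensorProduct X Y) :
    |‖slice f u‖ - ‖slice f' u‖| ≤ ‖f - f'‖ * ‖u‖ := by
  refine (abs_norm_sub_norm_le _ _).trans ?_
  rw [← slice_sub]
  exact norm_slice_le _ u

/-- Both sides are `(f ⊗ g) u`. This turns norming a slice in `Y` into norming a vector of `X`, to
which a boundary applies. -/
theorem apply_slice [CompleteSpace X] (f : StrongDual ℝ X) (g : StrongDual ℝ Y)
    (u : InjectiveTensorProduct X Y) : g (slice f u) = f (sliceRight g u) := by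
  induction u using UniformSpace.Completion.induction_on with
  | hp =>
    exact isClosed_eq (g.continuous.comp (slice f).continuous)
      (f.continuous.comp (sliceRight g).continuous)
  | ih w => rw [slice_coe, sliceRight_coe, apply_algSlice, apply_algSliceRight]

/-- Slicing is continuous on the dual unit ball with the topology of pointwise convergence. -/
theorem tendsto_slice {α : Type*} {l : Filter α} {φ : α → StrongDual ℝ X} {f : StrongDual ℝ X}
    (hφ : ∀ᶠ a in l, ‖φ a‖ ≤ 1) (hf : ‖f‖ ≤ 1)
    (h : ∀ x, Tendsto (fun a => φ a x) l (𝓝 (f x))) (u : InjectiveTensorProduct X Y) :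
    Tendsto (fun a => slice (φ a) u) l (𝓝 (slice f u)) := by
  have halg : ∀ w : AlgTensor X Y, Tendsto (fun a => algSlice (φ a) w) l (𝓝 (algSlice f w)) := by
    intro w
    obtain ⟨t, rfl⟩ := (AlgTensor.toTensor X Y).symm.surjective w
    induction t with
    | zero => simpa using tendsto_const_nhds
    | tmul x y =>
      simp only [algSlice_symm_tmul]
      exact (h x).smul_const y
    | add a b ha hb =>
      simp only [map_add]
      exact ha.add hb
  rw [Metric.tendsto_nhds]
  intro ε hε
  obtain ⟨w, hw⟩ := Metric.denseRange_iff.1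
    (UniformSpace.Completion.denseRange_coe (α := AlgTensor X Y)) u (ε / 3) (by positivity)
  filter_upwards [hφ, Metric.tendsto_nhds.1 (halg w) (ε / 3) (by positivity)] with a ha1 ha2
  rw [dist_eq_norm] at hw ha2 ⊢
  have h1 := norm_slice_le_norm ha1 (u - (w : InjectiveTensorProduct X Y))
  have h2 := norm_slice_le_norm hf (u - (w : InjectiveTensorProduct X Y))
  rw [map_sub, slice_coe] at h1 h2
  have h3 : slice (φ a) u - slice f u
      = (slice (φ a) u - algSlice (φ a) w) + (algSlice (φ a) w - algSlice f w)
        - (slice f u - algSlice f w) := by abel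
  rw [h3]
  refine (norm_sub_le _ _).trans_lt ?_
  linarith [norm_add_le (slice (φ a) u - algSlice (φ a) w) (algSlice (φ a) w - algSlice f w)]

/-- The injective norm is a supremum of norms of slices. -/
theorem exists_lt_norm_slice (u : InjectiveTensorProduct X Y) {η : ℝ} (hη : 0 < η) :
    ∃ f : StrongDual ℝ X, ‖f‖ ≤ 1 ∧ ‖u‖ - η < ‖slice f u‖ := by
  obtain ⟨w, hw⟩ := Metric.denseRange_iff.1
    (UniformSpace.Completion.denseRange_coe (α := AlgTensor X Y)) u (η / 3) (by positivity)
  have hlt : ‖w‖ - η / 3 < ‖w‖ := by linarith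
  conv_rhs at hlt => rw [norm_def]
  obtain ⟨⟨f, g⟩, hfg⟩ := exists_lt_of_lt_ciSup hlt
  have hf : ‖f.1‖ ≤ 1 := mem_closedBall_zero_iff.1 f.2
  have hg : ‖g.1‖ ≤ 1 := mem_closedBall_zero_iff.1 g.2
  refine ⟨f.1, hf, ?_⟩
  have h1 : |dualTensor f.1 g.1 (AlgTensor.toTensor X Y w)| ≤ ‖algSlice f.1 w‖ := by
    rw [← apply_algSlice, ← Real.norm_eq_abs]
    exact (g.1.le_opNorm _).trans (mul_le_of_le_one_left (norm_nonneg _) hg)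
  rw [dist_eq_norm] at hw
  have h2 := norm_slice_le_norm hf (u - (w : InjectiveTensorProduct X Y))
  rw [map_sub, slice_coe] at h2
  have h3 : ‖u‖ ≤ ‖u - (w : InjectiveTensorProduct X Y)‖ + ‖w‖ := by
    have := norm_add_le (u - (w : InjectiveTensorProduct X Y)) (w : InjectiveTensorProduct X Y)
    rwa [sub_add_cancel, UniformSpace.Completion.norm_coe] at this
  have h4 : ‖algSlice f.1 w‖ ≤ ‖slice f.1 u‖ + ‖slice f.1 u - algSlice f.1 w‖ := by
    have := norm_sub_le (slice f.1 u) (slice f.1 u - algSlice f.1 w)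
    rwa [sub_sub_cancel] at this
  dsimp only at hfg
  linarith

/-- The dual ball is `w*`-compact, and `f ↦ ‖slice f u‖` is `w*`-continuous on it. -/
theorem exists_norm_slice_eq (u : InjectiveTensorProduct X Y) :
    ∃ f : StrongDual ℝ X, ‖f‖ ≤ 1 ∧ ‖slice f u‖ = ‖u‖ := by
  let K : Set (WeakDual ℝ X) :=
    WeakDual.toStrongDual ⁻¹' Metric.closedBall (0 : StrongDual ℝ X) 1
  have hK : IsCompact K := WeakDual.isCompact_closedBall 0 1
  have hmem : ∀ f ∈ K, ‖WeakDual.toStrongDual f‖ ≤ 1 := fun f hf => mem_closedBall_zero_iff.1 hf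
  have hcont : ContinuousOn (fun f : WeakDual ℝ X => ‖slice (WeakDual.toStrongDual f) u‖) K := by
    intro f hf
    refine (tendsto_slice ?_ (hmem f hf) (fun x => ?_) u).norm
    · filter_upwards [self_mem_nhdsWithin] with g hg using hmem g hg
    · exact ((WeakDual.eval_continuous x).tendsto f).mono_left nhdsWithin_le_nhds
  have hne : K.Nonempty := ⟨0, by simp [K]⟩
  obtain ⟨f, hf, hmax⟩ := hK.exists_isMaxOn hne hcont
  refine ⟨WeakDual.toStrongDual f, hmem f hf, le_antisymm (norm_slice_le_norm (hmem f hf) u) ?_⟩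
  refine le_of_forall_pos_sub_le fun η hη => ?_
  obtain ⟨f', hf', hlt⟩ := exists_lt_norm_slice u hη
  exact hlt.le.trans (hmax (a := StrongDual.toWeakDual f') (mem_closedBall_zero_iff.2 hf'))

/-- The injective norm of `u ≠ 0` is attained on every boundary of `X`. -/
theorem IsBoundary.exists_norm_slice_eq [CompleteSpace X] {B : Set (StrongDual ℝ X)}
    (hB : IsBoundary B) {u : InjectiveTensorProduct X Y} (hu : u ≠ 0) :
    ∃ f ∈ B, ‖slice f u‖ = ‖u‖ := by
  obtain ⟨f₀, hf₀, hfu⟩ := SmoothRenorm.exists_norm_slice_eq u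
  obtain ⟨g, hg, hgu⟩ := exists_dual_vector'' ℝ (slice f₀ u)
  have hgu' : f₀ (sliceRight g u) = ‖u‖ := by
    rw [← apply_slice, hgu, hfu]
    rfl
  have hpos : 0 < ‖u‖ := norm_pos_iff.2 hu
  have hle : ‖u‖ ≤ ‖sliceRight g u‖ := by
    rw [← hgu']
    exact (le_abs_self _).trans ((f₀.le_opNorm _).trans (mul_le_of_le_one_left (norm_nonneg _) hf₀))
  have hpos' : 0 < ‖sliceRight g u‖ := hpos.trans_le hle
  obtain ⟨f, hf, hfx⟩ := hB.2 (‖sliceRight g u‖⁻¹ • sliceRight g u) (by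
    rw [mem_sphere_zero_iff_norm, norm_smul, norm_inv, norm_norm, inv_mul_cancel₀ hpos'.ne'])
  have hf1 : ‖f‖ ≤ 1 := mem_closedBall_zero_iff.1 (hB.1 hf)
  refine ⟨f, hf, le_antisymm (norm_slice_le_norm hf1 u) (hle.trans ?_)⟩
  have : f (sliceRight g u) = ‖sliceRight g u‖ := by
    rw [map_smul, smul_eq_mul, inv_mul_eq_one₀ hpos'.ne'] at hfx
    exact hfx.symm
  rw [← this, ← apply_slice]
  exact (le_abs_self _).trans ((g.le_opNorm _).trans (mul_le_of_le_one_left (norm_nonneg _) hg))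

end Slices

/-! ### Separated nets -/

section Nets

variable {P Q : Type*} [PseudoMetricSpace Q]

/-- Every set contains a net that is separated with respect to a pulled back metric. -/
theorem exists_separated_net (ι : P → Q) (s : Set P) {δ : ℝ} (hδ : 0 ≤ δ) :
    ∃ N ⊆ s, (N.Pairwise fun f g => δ < dist (ι f) (ι g)) ∧
      ∀ f ∈ s, ∃ g ∈ N, dist (ι f) (ι g) ≤ δ := by
  obtain ⟨N, hN⟩ := zorn_subset
    {N : Set P | N ⊆ s ∧ N.Pairwise fun f g => δ < dist (ι f) (ι g)} (by
      intro c hc hchain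
      refine ⟨⋃₀ c, ⟨sUnion_subset fun t ht => (hc ht).1, ?_⟩, fun t ht => subset_sUnion_of_mem ht⟩
      exact (pairwise_sUnion hchain.directedOn).2 fun t ht => (hc ht).2)
  refine ⟨N, hN.prop.1, hN.prop.2, fun f hf => ?_⟩
  by_contra! hfar
  have hmem : f ∈ N := by
    refine hN.le_of_ge (y := insert f N) ⟨insert_subset hf hN.prop.1, ?_⟩ (subset_insert f N)
      (mem_insert f N)
    refine hN.prop.2.insert fun g hg _ => ⟨hfar g hg, ?_⟩
    rw [dist_comm]
    exact hfar g hg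
  exact (hfar f hmem).not_ge (by simpa using hδ)

/-- A ball of radius `δ / 2` contains the image of at most one point of `M`, and finitely many such
balls cover the image. -/
theorem finite_of_separated {ι : P → Q} {M : Set P} {δ : ℝ} (hδ : 0 < δ)
    (hM : M.Pairwise fun f g => δ < dist (ι f) (ι g)) (htb : TotallyBounded (ι '' M)) :
    M.Finite := by
  rcases M.eq_empty_or_nonempty with rfl | ⟨f₀, -⟩
  · exact finite_empty
  have : Nonempty Q := ⟨ι f₀⟩
  obtain ⟨t, ht, hcov⟩ := Metric.totallyBounded_iff.1 htb (δ / 2) (by positivity)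
  have hex : ∀ f ∈ M, ∃ y ∈ t, dist (ι f) y < δ / 2 := by
    intro f hf
    simpa using hcov (mem_image_of_mem ι hf)
  choose! c hc hd using hex
  refine Set.Finite.of_injOn (f := c) (fun f hf => hc f hf) (fun f hf g hg hfg => ?_) ht
  by_contra hne
  have h1 := hM hf hg hne
  have h2 := dist_triangle_right (ι f) (ι g) (c f)
  have h3 := hd f hf
  have h4 := hd g hg
  rw [← hfg] at h4
  linarith

end Nets

/-! ### Decomposition into relatively open parts of `w*`-compact sets -/

section Decomposition

variable {X : Type*} [NormedAddCommGroup X] [NormedSpace ℝ X]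

/-- A sequence of `w*`-closed subsets `C j` of the dual ball, with `w*`-closed parts `D j`, such
that the differences `C j \ D j` are `w*`-LRC and cover all `C j`. -/
structure IsLRCFamily (C D : ℕ → Set (StrongDual ℝ X)) : Prop where
  isClosed_left : ∀ j, IsClosed (WeakDual.toStrongDual ⁻¹' C j : Set (WeakDual ℝ X))
  isClosed_right : ∀ j, IsClosed (WeakDual.toStrongDual ⁻¹' D j : Set (WeakDual ℝ X))
  right_subset : ∀ j, D j ⊆ C j
  norm_le : ∀ j, ∀ f ∈ C j, ‖f‖ ≤ 1
  isWeakStarLRC : ∀ j, IsWeakStarLRC (C j \ D j)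
  cover : ∀ j, ∀ f ∈ C j, ∃ i, f ∈ C i \ D i

/-- The set `C` for a pair `(n, m)` is the part of `K m` in the dual ball and in the `w*`-closure of
`E n`; `D` removes the `w*`-open set `V n` where `E n` is locally relatively compact. The
intersection with `K m` keeps `C` inside `E`, which gives the covering property. -/
theorem exists_isLRCFamily {E : ℕ → Set (StrongDual ℝ X)} (hLRC : ∀ n, IsWeakStarLRC (E n))
    (hcompact : IsSigmaWeakStarCompact (⋃ n, E n)) :
    ∃ C D : ℕ → Set (StrongDual ℝ X), IsLRCFamily C D ∧
      ∀ f ∈ ⋃ n, E n, ‖f‖ ≤ 1 → ∃ j, f ∈ C j := by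
  obtain ⟨K, hK, hKE⟩ := hcompact
  let V : ℕ → Set (WeakDual ℝ X) := fun n =>
    ⋃₀ {U | IsOpen U ∧ IsCompact (closure (E n ∩ StrongDual.toWeakDual ⁻¹' U))}
  have hV : ∀ n, IsOpen (V n) := fun n => isOpen_sUnion fun U hU => hU.1
  let C' : ℕ → ℕ → Set (WeakDual ℝ X) := fun n m =>
    K m ∩ closure (StrongDual.toWeakDual '' E n) ∩
      WeakDual.toStrongDual ⁻¹' Metric.closedBall (0 : StrongDual ℝ X) 1
  have hC' : ∀ n m, IsClosed (C' n m) := fun n m =>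
    ((hK m).isClosed.inter isClosed_closure).inter (WeakDual.isClosed_closedBall 0 1)
  have hmem : ∀ n m, ∀ f ∈ E n, StrongDual.toWeakDual f ∈ K m → ‖f‖ ≤ 1 →
      StrongDual.toWeakDual f ∈ C' n m ∩ V n := by
    intro n m f hf hfK hf1
    obtain ⟨U, hUo, hfU, hUc⟩ := hLRC n f hf
    exact ⟨⟨⟨hfK, subset_closure (mem_image_of_mem _ hf)⟩, mem_closedBall_zero_iff.2 hf1⟩,
      mem_sUnion.2 ⟨U, ⟨hUo, hUc⟩, hfU⟩⟩
  have hpair : ∀ n m, ∀ f ∈ E n, StrongDual.toWeakDual f ∈ K m → ‖f‖ ≤ 1 → ∃ j : ℕ,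
      StrongDual.toWeakDual f ∈ C' j.unpair.1 j.unpair.2 ∩ V j.unpair.1 := by
    intro n m f hf hfK hf1
    refine ⟨Nat.pair n m, ?_⟩
    rw [Nat.unpair_pair]
    exact hmem n m f hf hfK hf1
  refine ⟨fun j => StrongDual.toWeakDual ⁻¹' C' j.unpair.1 j.unpair.2,
    fun j => StrongDual.toWeakDual ⁻¹' (C' j.unpair.1 j.unpair.2 \ V j.unpair.1),
    ⟨fun j => hC' _ _, fun j => (hC' _ _).sdiff (hV _), fun j => preimage_mono sdiff_subset,
      fun j f hf => mem_closedBall_zero_iff.1 hf.2, fun j f hf => ?_, fun j f hf => ?_⟩,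
    fun f hf hf1 => ?_⟩
  · set n := j.unpair.1
    set m := j.unpair.2
    have hfV : StrongDual.toWeakDual f ∈ V n := by
      by_contra h
      exact hf.2 ⟨hf.1, h⟩
    obtain ⟨U, ⟨hUo, hUc⟩, hfU⟩ := mem_sUnion.1 hfV
    refine ⟨U, hUo, hfU, hUc.closure_of_subset ?_⟩
    rintro g ⟨⟨hgC, -⟩, hgU⟩
    have h1 : StrongDual.toWeakDual g ∈ closure (U ∩ StrongDual.toWeakDual '' E n) :=
      hUo.inter_closure ⟨hgU, hgC.1.2⟩
    have h2 : U ∩ StrongDual.toWeakDual '' E n ⊆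
        StrongDual.toWeakDual '' closure (E n ∩ StrongDual.toWeakDual ⁻¹' U) := by
      rintro _ ⟨hU, g', hg', rfl⟩
      exact mem_image_of_mem _ (subset_closure ⟨hg', hU⟩)
    -- A norm compact set is `w*`-compact, hence `w*`-closed. So passing to the `w*`-closure of `E
    -- n` adds no points in `U` outside the norm closure, and `C ∩ V n` is again `w*`-LRC.
    have h3 : IsClosed (StrongDual.toWeakDual '' closure (E n ∩ StrongDual.toWeakDual ⁻¹' U)) :=
      (hUc.image NormedSpace.Dual.toWeakDual_continuous).isClosed
    obtain ⟨g', hg', hgg'⟩ := closure_minimal h2 h3 h1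
    rwa [← StrongDual.toWeakDual.injective hgg']
  · have hfK : StrongDual.toWeakDual f ∈ StrongDual.toWeakDual '' ⋃ n, E n := by
      rw [← hKE]
      exact mem_iUnion.2 ⟨_, hf.1.1⟩
    obtain ⟨f', hf', hff'⟩ := hfK
    rw [StrongDual.toWeakDual.injective hff'] at hf'
    obtain ⟨n, hn⟩ := mem_iUnion.1 hf'
    obtain ⟨i, hi⟩ := hpair n _ f hn hf.1.1 (mem_closedBall_zero_iff.1 hf.2)
    exact ⟨i, hi.1, fun h => h.2 hi.2⟩
  · have hfK : StrongDual.toWeakDual f ∈ ⋃ m, K m := by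
      rw [hKE]
      exact mem_image_of_mem _ hf
    obtain ⟨m, hm⟩ := mem_iUnion.1 hfK
    obtain ⟨n, hn⟩ := mem_iUnion.1 hf
    obtain ⟨j, hj⟩ := hpair n m f hn hm hf1
    exact ⟨j, hj.1⟩

end Decomposition

/-! ### Weights that jump at `w*`-limits -/

section Weights

variable {X : Type*} [NormedAddCommGroup X] [NormedSpace ℝ X]

/-- The weight `1 + ∑ j, e j * (1_{C j} + 1_{D j})`. -/
noncomputable def weight (C D : ℕ → Set (StrongDual ℝ X)) (e : ℕ → ℝ) (f : StrongDual ℝ X) : ℝ :=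
  1 + ∑' j, e j * ((C j).indicator 1 f + (D j).indicator 1 f)

variable {C D : ℕ → Set (StrongDual ℝ X)} {e : ℕ → ℝ} {a : ℝ}

theorem indicator_one_mem_Icc (s : Set (StrongDual ℝ X)) (f : StrongDual ℝ X) :
    s.indicator (1 : StrongDual ℝ X → ℝ) f ∈ Icc (0 : ℝ) 1 := by
  by_cases hf : f ∈ s <;> simp [hf]

theorem mul_mem_Icc {t x : ℝ} (ht : 0 < t) {y : ℝ} (hx : x ∈ Icc (0 : ℝ) 1)
    (hy : y ∈ Icc (0 : ℝ) 1) : t * (x + y) ∈ Icc 0 (2 * t) := by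
  obtain ⟨hx0, hx1⟩ := hx
  obtain ⟨hy0, hy1⟩ := hy
  exact ⟨by positivity, by nlinarith⟩

theorem summable_mul_add (he : ∀ j, 0 < e j) (hs : HasSum e a) {c d : ℕ → ℝ}
    (hc : ∀ j, c j ∈ Icc (0 : ℝ) 1) (hd : ∀ j, d j ∈ Icc (0 : ℝ) 1) :
    Summable fun j => e j * (c j + d j) :=
  Summable.of_nonneg_of_le (fun j => (mul_mem_Icc (he j) (hc j) (hd j)).1)
    (fun j => (mul_mem_Icc (he j) (hc j) (hd j)).2) (hs.summable.mul_left 2)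

theorem one_le_weight (he : ∀ j, 0 < e j) (f : StrongDual ℝ X) : 1 ≤ weight C D e f :=
  le_add_of_nonneg_right (tsum_nonneg fun j =>
    (mul_mem_Icc (he j) (indicator_one_mem_Icc _ f) (indicator_one_mem_Icc _ f)).1)

theorem weight_le (he : ∀ j, 0 < e j) (hs : HasSum e a) (f : StrongDual ℝ X) :
    weight C D e f ≤ 1 + 2 * a := by
  have h := (summable_mul_add he hs (fun j => indicator_one_mem_Icc (C j) f)
    (fun j => indicator_one_mem_Icc (D j) f)).hasSum
  have := hasSum_le (fun j => (mul_mem_Icc (he j) (indicator_one_mem_Icc (C j) f)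
    (indicator_one_mem_Icc (D j) f)).2) h (hs.mul_left 2)
  simp only [weight]
  linarith

theorem add_le_weight_of_mem (he : ∀ j, 0 < e j) (hs : HasSum e a) {f : StrongDual ℝ X} {j : ℕ}
    (hf : f ∈ C j) : 1 + e j ≤ weight C D e f := by
  have h := (summable_mul_add he hs (fun j => indicator_one_mem_Icc (C j) f)
    (fun j => indicator_one_mem_Icc (D j) f)).hasSum
  have h1 := le_hasSum h j fun i _ =>
    (mul_mem_Icc (he i) (indicator_one_mem_Icc (C i) f) (indicator_one_mem_Icc (D i) f)).1
  have h2 := (indicator_one_mem_Icc (D j) f).1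
  have h3 := he j
  simp only [indicator_of_mem hf, Pi.one_apply] at h1
  simp only [weight]
  nlinarith

/-- Along an ultrafilter, an indicator function is eventually constant. -/
theorem exists_eventually_indicator {α : Type*} (F : Ultrafilter α) (φ : α → StrongDual ℝ X)
    (s : Set (StrongDual ℝ X)) : ∃ c : ℝ, c ∈ Icc (0 : ℝ) 1 ∧
      Tendsto (fun i => s.indicator (1 : StrongDual ℝ X → ℝ) (φ i)) F (𝓝 c) ∧
      ((∀ᶠ i in F, φ i ∈ s) ∨ c = 0) := by
  rcases F.em fun i => φ i ∈ s with h | h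
  · refine ⟨1, ⟨zero_le_one, le_rfl⟩, tendsto_const_nhds.congr' ?_, Or.inl h⟩
    filter_upwards [h] with i hi
    simp [hi]
  · refine ⟨0, ⟨le_rfl, zero_le_one⟩, tendsto_const_nhds.congr' ?_, Or.inr rfl⟩
    filter_upwards [h] with i hi
    simp [hi]

theorem mem_of_tendsto_toWeakDual {α : Type*} {l : Filter α} [l.NeBot] {φ : α → StrongDual ℝ X}
    {f : StrongDual ℝ X} {s : Set (StrongDual ℝ X)}
    (hs : IsClosed (WeakDual.toStrongDual ⁻¹' s : Set (WeakDual ℝ X)))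
    (hφ : Tendsto (fun i => StrongDual.toWeakDual (φ i)) l (𝓝 (StrongDual.toWeakDual f)))
    (h : ∀ᶠ i in l, φ i ∈ s) : f ∈ s :=
  hs.mem_of_tendsto hφ h

/-- Since `C j` and `D j` are `w*`-closed, the limit of each indicator is at most its value at `f`.
Comparing the series term by term, a single jump contributes a full `e j`. -/
theorem exists_tendsto_weight (hCD : IsLRCFamily C D) (he : ∀ j, 0 < e j) (hs : HasSum e a)
    {α : Type*} (F : Ultrafilter α) (φ : α → StrongDual ℝ X) :
    ∃ L, Tendsto (fun i => weight C D e (φ i)) F (𝓝 L) ∧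
      ((∀ j, ∀ᶠ i in F, φ i ∉ C j) → L = 1) ∧
      ∀ f, Tendsto (fun i => StrongDual.toWeakDual (φ i)) F (𝓝 (StrongDual.toWeakDual f)) →
        ∀ j, (f ∈ C j ∧ ∀ᶠ i in F, φ i ∉ C j) ∨ (f ∈ D j ∧ ∀ᶠ i in F, φ i ∉ D j) →
          L + e j ≤ weight C D e f := by
  choose c hc hct hc0 using fun j => exists_eventually_indicator F φ (C j)
  choose d hd hdt hd0 using fun j => exists_eventually_indicator F φ (D j)
  have hsum := summable_mul_add he hs hc hd
  have hzero : ∀ {s : Set (StrongDual ℝ X)} {t : ℝ}, (∀ᶠ i in F, φ i ∉ s) →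
      ((∀ᶠ i in F, φ i ∈ s) ∨ t = 0) → t = 0 := by
    rintro s t h (h' | h')
    · obtain ⟨i, h1, h2⟩ := (h.and h').exists
      exact absurd h2 h1
    · exact h'
  refine ⟨1 + ∑' j, e j * (c j + d j), ?_, fun h => ?_, fun f hf j hj => ?_⟩
  · refine tendsto_const_nhds.add (tendsto_tsum_of_dominated_convergence (bound := fun j => 2 * e j)
      (hs.summable.mul_left 2) (fun j => ((hct j).add (hdt j)).const_mul (e j)) ?_)
    refine Eventually.of_forall fun i j => ?_
    have := mul_mem_Icc (he j) (indicator_one_mem_Icc (C j) (φ i)) (indicator_one_mem_Icc (D j) (φ i))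
    rw [Real.norm_of_nonneg this.1]
    exact this.2
  · have h0 : ∀ j, e j * (c j + d j) = 0 := fun j => by
      rw [hzero (h j) (hc0 j), hzero ((h j).mono fun i hi hiD => hi (hCD.right_subset j hiD)) (hd0 j)]
      simp
    simp [h0]
  · have hle : ∀ {s : Set (StrongDual ℝ X)} {t : ℝ}, t ∈ Icc (0 : ℝ) 1 →
        IsClosed (WeakDual.toStrongDual ⁻¹' s : Set (WeakDual ℝ X)) →
        ((∀ᶠ i in F, φ i ∈ s) ∨ t = 0) → t ≤ s.indicator 1 f := by
      rintro s t ht hscl (h' | h')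
      · simpa [mem_of_tendsto_toWeakDual hscl hf h'] using ht.2
      · rw [h']
        exact (indicator_one_mem_Icc s f).1
    have hcle := fun i => hle (hc i) (hCD.isClosed_left i) (hc0 i)
    have hdle := fun i => hle (hd i) (hCD.isClosed_right i) (hd0 i)
    have hw := summable_mul_add he hs (fun j => indicator_one_mem_Icc (C j) f)
      (fun j => indicator_one_mem_Icc (D j) f)
    have hjump : 1 ≤ ((C j).indicator 1 f + (D j).indicator 1 f) - (c j + d j) := by
      rcases hj with ⟨h1, h2⟩ | ⟨h1, h2⟩
      · rw [hzero h2 (hc0 j), indicator_of_mem h1]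
        have := hdle j
        simp only [Pi.one_apply]
        linarith
      · rw [hzero h2 (hd0 j), indicator_of_mem h1]
        have := hcle j
        simp only [Pi.one_apply]
        linarith
    have h1 := le_hasSum (hw.hasSum.sub hsum.hasSum) j fun i _ => by
      rw [← mul_sub]
      exact mul_nonneg (he i).le (by linarith [hcle i, hdle i])
    rw [← mul_sub] at h1
    have h2 := mul_le_mul_of_nonneg_left hjump (he j).le
    simp only [weight]
    linarith

end Weights

/-! ### Local finiteness of the weighted slices -/

section LocalFiniteness

variable {X Y : Type*} [NormedAddCommGroup X] [NormedSpace ℝ X]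
  [NormedAddCommGroup Y] [NormedSpace ℝ Y]

/-- The points of `C j \ D j` that lie in no earlier difference. -/
def level (C D : ℕ → Set (StrongDual ℝ X)) (j : ℕ) : Set (StrongDual ℝ X) :=
  {f | f ∈ C j \ D j ∧ ∀ i < j, f ∉ C i \ D i}

/-- Nets `N j` of the levels, separated for the joint distance of points and weights. -/
structure IsLevelNet (C D : ℕ → Set (StrongDual ℝ X)) (e : ℕ → ℝ)
    (N : ℕ → Set (StrongDual ℝ X)) : Prop where
  subset : ∀ j, N j ⊆ level C D j
  separated : ∀ j, (N j).Pairwise fun f g =>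
    e j / 80 < dist (f, weight C D e f) (g, weight C D e g)
  exists_dist_le : ∀ j, ∀ f ∈ level C D j, ∃ g ∈ N j,
    dist (f, weight C D e f) (g, weight C D e g) ≤ e j / 80

variable {C D N : ℕ → Set (StrongDual ℝ X)} {e : ℕ → ℝ} {a : ℝ}

theorem exists_isLevelNet (he : ∀ j, 0 < e j) : ∃ N, IsLevelNet C D e N := by
  choose N h1 h2 h3 using fun j => exists_separated_net (fun f => (f, weight C D e f))
    (level C D j) (δ := e j / 80) (by linarith [he j])
  exact ⟨N, h1, h2, h3⟩

theorem IsLRCFamily.exists_mem_level (hCD : IsLRCFamily C D) {f : StrongDual ℝ X} {j : ℕ}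
    (hf : f ∈ C j) : ∃ i, f ∈ level C D i := by
  classical
  have h := hCD.cover j f hf
  exact ⟨Nat.find h, Nat.find_spec h, fun i hi => Nat.find_min h hi⟩

theorem IsLevelNet.norm_le (hCD : IsLRCFamily C D) (hN : IsLevelNet C D e N) (i : Σ j, N j) :
    ‖(i.2 : StrongDual ℝ X)‖ ≤ 1 :=
  hCD.norm_le i.1 _ (hN.subset i.1 i.2.2).1.1

variable [CompleteSpace Y]

/-- The seminorm `u ↦ (weight f + e j / 8) * ‖(f ⊗ id) u‖` for `f` in the net `N j`. -/
noncomputable def sliceSeminorm (C D N : ℕ → Set (StrongDual ℝ X)) (e : ℕ → ℝ)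
    (i : Σ j, N j) : Seminorm ℝ (InjectiveTensorProduct X Y) :=
  (normSeminorm ℝ Y).comp
    ((weight C D e i.2 + e i.1 / 8) • slice (Y := Y) (i.2 : StrongDual ℝ X)).toLinearMap

theorem sliceSeminorm_apply (he : ∀ j, 0 < e j) (i : Σ j, N j) (u : InjectiveTensorProduct X Y) :
    sliceSeminorm C D N e i u
      = (weight C D e i.2 + e i.1 / 8) * ‖slice (i.2 : StrongDual ℝ X) u‖ := by
  have h0 : 0 ≤ weight C D e i.2 + e i.1 / 8 := by
    linarith [he i.1, one_le_weight (C := C) (D := D) he i.2]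
  simp [sliceSeminorm, norm_smul, abs_of_nonneg h0]

/-- Passing to the nets does not decrease the relevant weighted slices. -/
theorem weight_mul_norm_slice_le_one (hCD : IsLRCFamily C D) (hN : IsLevelNet C D e N)
    (he : ∀ j, 0 < e j) (hs : HasSum e a) (ha : a ≤ 1 / 8) {u : InjectiveTensorProduct X Y}
    (hu : ∀ i, sliceSeminorm C D N e i u ≤ 1) {f : StrongDual ℝ X} {j : ℕ} (hf : f ∈ C j)
    (hfu : ‖u‖ / 2 ≤ ‖slice f u‖) : weight C D e f * ‖slice f u‖ ≤ 1 := by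
  obtain ⟨i, hi⟩ := hCD.exists_mem_level hf
  obtain ⟨g, hg, hfg⟩ := hN.exists_dist_le i f hi
  have hq := hu ⟨i, g, hg⟩
  rw [sliceSeminorm_apply he] at hq
  dsimp only at hq
  rw [Prod.dist_eq, max_le_iff, dist_eq_norm, Real.dist_eq] at hfg
  have h1 := (abs_le.1 (abs_norm_slice_sub_le f g u)).2
  have h2 := (abs_le.1 hfg.2).2
  have hei : e i ≤ 1 / 8 := (le_hasSum hs i fun j _ => (he j).le).trans ha
  have hei0 := he i
  have hwf := weight_le (C := C) (D := D) he hs f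
  have hwf1 := one_le_weight (C := C) (D := D) he f
  set w := weight C D e f
  set w' := weight C D e g
  set s := ‖slice f u‖
  set s' := ‖slice g u‖
  have hs0 : 0 ≤ s := norm_nonneg _
  -- As `‖u‖ ≤ 2 * s`, replacing `f` by `g` costs the slice at most the fraction `e i / 40`. The
  -- weight loses at most `e i / 80` of its bonus `10 * (e i / 80)`, and the remaining `9 * (e i /
  -- 80)` covers the first loss because `w ≤ 5 / 4`.
  have h3 : ‖f - g‖ * ‖u‖ ≤ e i / 80 * (2 * s) := by
    refine mul_le_mul hfg.1 (by linarith) (norm_nonneg _) (by positivity)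
  have h4 : s * (1 - e i / 40) ≤ s' := by linarith
  have h5 : w + 9 * (e i / 80) ≤ w' + e i / 8 := by linarith
  have h6 : (w + 9 * (e i / 80)) * (s * (1 - e i / 40)) ≤ (w' + e i / 8) * s' :=
    mul_le_mul h5 h4 (mul_nonneg hs0 (by linarith)) (by linarith)
  have h7 : w * s ≤ (w + 9 * (e i / 80)) * (s * (1 - e i / 40)) := by
    have : w ≤ (w + 9 * (e i / 80)) * (1 - e i / 40) := by nlinarith
    calc w * s ≤ ((w + 9 * (e i / 80)) * (1 - e i / 40)) * s := by gcongr
      _ = _ := by ring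
  linarith

/-- An ultrafilter of indices that escapes every finite set and lives on a single level converges
to a point outside that level. -/
theorem mem_right_of_tendsto (hCD : IsLRCFamily C D) (hN : IsLevelNet C D e N)
    (he : ∀ j, 0 < e j) (hs : HasSum e a) {F : Ultrafilter (Σ j, N j)}
    (hF : (F : Filter (Σ j, N j)) ≤ cofinite) {f : StrongDual ℝ X}
    (hf : Tendsto (fun i : Σ j, N j => StrongDual.toWeakDual (i.2 : StrongDual ℝ X)) F
      (𝓝 (StrongDual.toWeakDual f))) {j : ℕ} (hj : ∀ᶠ i : Σ j, N j in F, i.1 = j) (hfC : f ∈ C j) :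
    f ∈ D j := by
  by_contra hfD
  obtain ⟨U, hUo, hfU, hUc⟩ := hCD.isWeakStarLRC j f ⟨hfC, hfD⟩
  let M : Set (StrongDual ℝ X) := N j ∩ StrongDual.toWeakDual ⁻¹' U
  have hM : M.Finite := by
    refine finite_of_separated (ι := fun f => (f, weight C D e f)) (δ := e j / 80)
      (by linarith [he j]) ((hN.separated j).mono inter_subset_left) ?_
    -- Separation is in the joint distance, so total boundedness needs compactness of the points
    -- near `f` and also of the range of the weights.
    refine (hUc.prod (isCompact_Icc (a := (1 : ℝ)) (b := 1 + 2 * a))).totallyBounded.subset ?_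
    rintro _ ⟨g, ⟨hg, hgU⟩, rfl⟩
    exact ⟨subset_closure ⟨(hN.subset j hg).1, hgU⟩, one_le_weight he g, weight_le he hs g⟩
  have hfin : {i : Σ j, N j | i.1 = j ∧ (i.2 : StrongDual ℝ X) ∈ M}.Finite := by
    refine Set.Finite.of_injOn (f := fun i : Σ j, N j => (i.2 : StrongDual ℝ X))
      (fun i hi => hi.2) ?_ hM
    rintro ⟨i, g, hg⟩ ⟨rfl, -⟩ ⟨i', g', hg'⟩ ⟨rfl, -⟩ h
    dsimp only at h
    subst h
    rfl
  have hev : ∀ᶠ i : Σ j, N j in F, i.1 = j ∧ (i.2 : StrongDual ℝ X) ∈ M := by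
    filter_upwards [hj, hf.eventually (hUo.mem_nhds hfU)] with i hi hiU
    refine ⟨hi, ?_, hiU⟩
    subst hi
    exact i.2.2
  obtain ⟨i, h1, h2⟩ := (hev.and (hF hfin.compl_mem_cofinite)).exists
  exact h2 h1

/-- The uniform gap below the thresholds `1 - e j / 8` is what makes the sum of cutoffs finite on a
whole neighbourhood of `u`. -/
theorem exists_finset_sliceSeminorm_le (hCD : IsLRCFamily C D) (hN : IsLevelNet C D e N)
    (he : ∀ j, 0 < e j) (hs : HasSum e a) (ha : a ≤ 1 / 8) {u : InjectiveTensorProduct X Y}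
    (hbd : ∃ f j, f ∈ C j ∧ ‖slice f u‖ = ‖u‖) (hu : ∀ i, sliceSeminorm C D N e i u ≤ 1) :
    ∃ S : Finset (Σ j, N j), ∃ η > 0, ∀ i ∉ S,
      sliceSeminorm C D N e i u ≤ 1 - e i.1 / 8 - η := by
  obtain ⟨fB, jB, hfB, hfBu⟩ := hbd
  have hBle := weight_mul_norm_slice_le_one hCD hN he hs ha hu hfB
    (by rw [hfBu]; linarith [norm_nonneg u])
  rw [hfBu] at hBle
  have hBw := add_le_weight_of_mem (D := D) he hs hfB
  have hu1 : (1 + e jB) * ‖u‖ ≤ 1 :=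
    (mul_le_mul_of_nonneg_right hBw (norm_nonneg u)).trans hBle
  have hule : ‖u‖ ≤ 1 := by nlinarith [he jB, norm_nonneg u]
  have hei : ∀ i, e i ≤ 1 / 8 := fun i => (le_hasSum hs i fun j _ => (he j).le).trans ha
  by_contra! hcon
  let q : (Σ j, N j) → ℝ := fun i => sliceSeminorm C D N e i u
  let gap : (Σ j, N j) → ℝ := fun i => max 0 (1 - e i.1 / 8 - q i)
  -- If the claim fails, almost maximal indices lie outside every finite set, so an ultrafilter can
  -- escape all finite sets while `gap` tends to `0`.
  have hne : (cofinite ⊓ comap gap (𝓝 0)).NeBot := by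
    rw [inf_neBot_iff]
    intro S hS T hT
    obtain ⟨η, hη, hηT⟩ := (Metric.nhds_basis_ball.comap gap).mem_iff.1 hT
    obtain ⟨i, hiS, hi⟩ := hcon (Set.Finite.toFinset hS) η hη
    have hiS' : i ∈ S := by
      by_contra h
      exact hiS ((Set.Finite.mem_toFinset _).2 h)
    refine ⟨i, hiS', hηT ?_⟩
    rw [mem_preimage, mem_ball_zero_iff, Real.norm_of_nonneg (le_max_left _ _), max_lt_iff]
    exact ⟨hη, by simp only [q]; linarith⟩
  let F : Ultrafilter (Σ j, N j) := Ultrafilter.of (cofinite ⊓ comap gap (𝓝 0))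
  have hF : (F : Filter (Σ j, N j)) ≤ cofinite ⊓ comap gap (𝓝 0) := Ultrafilter.of_le _
  have hFc : (F : Filter (Σ j, N j)) ≤ cofinite := hF.trans inf_le_left
  have hgap : Tendsto gap F (𝓝 0) := tendsto_iff_comap.2 (hF.trans inf_le_right)
  let φ : (Σ j, N j) → StrongDual ℝ X := fun i => i.2
  have hφ1 : ∀ i, ‖φ i‖ ≤ 1 := hN.norm_le hCD
  -- a `w*`-limit along the ultrafilter
  obtain ⟨f, hf1, hf⟩ : ∃ f : StrongDual ℝ X, ‖f‖ ≤ 1 ∧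
      Tendsto (fun i => StrongDual.toWeakDual (φ i)) F (𝓝 (StrongDual.toWeakDual f)) := by
    obtain ⟨f, hfK, hf⟩ := (WeakDual.isCompact_closedBall (0 : StrongDual ℝ X) 1).ultrafilter_le_nhds
      (F.map fun i => StrongDual.toWeakDual (φ i))
      (le_principal_iff.2 (Ultrafilter.mem_map.2 (Eventually.of_forall fun i =>
        mem_closedBall_zero_iff.2 (hφ1 i))))
    exact ⟨WeakDual.toStrongDual f, mem_closedBall_zero_iff.1 hfK, hf⟩
  have hslice : Tendsto (fun i => ‖slice (φ i) u‖) F (𝓝 ‖slice f u‖) :=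
    (tendsto_slice (Eventually.of_forall hφ1) hf1
      (fun x => ((WeakDual.eval_continuous x).tendsto _).comp hf) u).norm
  obtain ⟨L, hL, hL1, hLjump⟩ := exists_tendsto_weight hCD he hs F φ
  have hLle : L ≤ 5 / 4 := by
    have : L ≤ 1 + 2 * a := le_of_tendsto hL (Eventually.of_forall fun i => weight_le he hs _)
    linarith
  have hLge : 1 ≤ L := ge_of_tendsto hL (Eventually.of_forall fun i => one_le_weight he _)
  set s := ‖slice f u‖ with hsdef
  have hs0 : 0 ≤ s := norm_nonneg _
  have hqge : ∀ i, 1 - e i.1 / 8 - gap i ≤ (weight C D e (φ i) + e i.1 / 8) * ‖slice (φ i) u‖ := by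
    intro i
    have : 1 - e i.1 / 8 - q i ≤ gap i := le_max_right _ _
    have hqi : q i = (weight C D e (φ i) + e i.1 / 8) * ‖slice (φ i) u‖ := sliceSeminorm_apply he i u
    rw [← hqi]
    linarith
  by_cases hconst : ∃ j, ∀ᶠ i : Σ j, N j in F, i.1 = j
  · obtain ⟨j, hj⟩ := hconst
    have hfC : f ∈ C j := mem_of_tendsto_toWeakDual (hCD.isClosed_left j) hf (by
      filter_upwards [hj] with i hi
      subst hi
      exact (hN.subset _ i.2.2).1.1)
    have hfD : f ∈ D j := mem_right_of_tendsto hCD hN he hs hFc hf hj hfC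
    have hjump := hLjump f hf j (Or.inr ⟨hfD, by
      filter_upwards [hj] with i hi
      subst hi
      exact (hN.subset _ i.2.2).1.2⟩)
    -- On a single level, `(L + e j) * s ≤ 1` from the jump at `D j` and this bound force `s ≤ 1 /
    -- 7`, whereas the bound alone gives `s ≥ 1 / 2`.
    have hlim : 1 - e j / 8 ≤ (L + e j / 8) * s := by
      have h1 : Tendsto (fun i => 1 - e j / 8 - gap i) F (𝓝 (1 - e j / 8 - 0)) :=
        tendsto_const_nhds.sub hgap
      rw [sub_zero] at h1
      refine le_of_tendsto_of_tendsto h1 ((hL.add_const (e j / 8)).mul hslice) ?_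
      filter_upwards [hj] with i hi
      have := hqge i
      rwa [hi] at this
    have hej := hei j
    have hej0 := he j
    have hs2 : 1 / 2 ≤ s := by
      by_contra! h
      nlinarith
    have hle := weight_mul_norm_slice_le_one hCD hN he hs ha hu hfC (by linarith)
    have := mul_le_mul_of_nonneg_right hjump hs0
    nlinarith
  · have hat : ∀ m, ∀ᶠ i : Σ j, N j in F, m < i.1 := by
      intro m
      have : ∀ᶠ i : Σ j, N j in F, ∀ j ∈ Finset.range (m + 1), i.1 ≠ j :=
        (Filter.eventually_all_finset _).2 fun j _ =>
          Ultrafilter.eventually_not.2 fun h => hconst ⟨j, h⟩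
      filter_upwards [this] with i hi
      by_contra! h
      exact hi i.1 (Finset.mem_range.2 (by omega)) rfl
    have htop : Tendsto (fun i : Σ j, N j => i.1) F atTop :=
      tendsto_atTop.2 fun m => (hat m).mono fun i hi => hi.le
    have he0 : Tendsto (fun i : Σ j, N j => e i.1 / 8) F (𝓝 0) := by
      simpa using (hs.summable.tendsto_atTop_zero.comp htop).div_const 8
    have hlim : 1 ≤ L * s := by
      have h1 : Tendsto (fun i => 1 - e i.1 / 8 - gap i) F (𝓝 (1 - 0 - 0)) :=
        (tendsto_const_nhds.sub he0).sub hgap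
      have h2 : Tendsto (fun i => (weight C D e (φ i) + e i.1 / 8) * ‖slice (φ i) u‖) F
          (𝓝 ((L + 0) * s)) := (hL.add he0).mul hslice
      simpa using le_of_tendsto_of_tendsto' h1 h2 hqge
    -- If every `C j` is left, then `L = 1` and `1 ≤ s ≤ ‖u‖`, contradicting `(1 + e jB) * ‖u‖ ≤ 1`.
    by_cases hnone : ∀ j, ∀ᶠ i in F, φ i ∉ C j
    · rw [hL1 hnone, one_mul] at hlim
      have : s ≤ ‖u‖ := norm_slice_le_norm hf1 u
      have hj0 := he jB
      nlinarith
    · push Not at hnone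
      obtain ⟨j₀, hj₀⟩ := hnone
      have hfC₀ : f ∈ C j₀ := mem_of_tendsto_toWeakDual (hCD.isClosed_left j₀) hf hj₀
      obtain ⟨j, hfC, hfD⟩ := hCD.cover j₀ f hfC₀
      have hs2 : 1 / 2 ≤ s := by
        by_contra! h
        nlinarith
      have hle := weight_mul_norm_slice_le_one hCD hN he hs ha hu hfC (by linarith)
      -- Points that stay in `C j` eventually avoid the closed set `D j`, so their level is at most
      -- `j`, although levels tend to infinity. Otherwise the jump at `C j` gives `(L + e j) * s ≤ 1
      -- ≤ L * s`.
      rcases F.em fun i => φ i ∈ C j with hC | hC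
      · have hD : ∀ᶠ i in F, φ i ∉ D j :=
          hf.eventually ((hCD.isClosed_right j).isOpen_compl.mem_nhds hfD)
        obtain ⟨i, h1, h2, h3⟩ := (hC.and (hD.and (hat j))).exists
        exact (hN.subset i.1 i.2.2).2 j h3 ⟨h1, h2⟩
      · have hjump := hLjump f hf j (Or.inl ⟨hfC, hC⟩)
        have := mul_le_mul_of_nonneg_right hjump hs0
        nlinarith [he j]

end LocalFiniteness

end SmoothRenorm

/-! ### Assembly of the approximating norm -/

/-- If countably many `w*`-LRC sets have a `σ`-`w*`-compact union that contains a boundary of `X`,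
and the norm of `Y` is `C^k` smooth, then the injective norm of `X ⊗ Y` can be approximated by
`C^k` smooth norms. -/
theorem mainTheorem1 {X : Type*} {Y : Type*}
    [NormedAddCommGroup X] [NormedSpace ℝ X] [CompleteSpace X]
    [NormedAddCommGroup Y] [NormedSpace ℝ Y] [CompleteSpace Y]
    (E : ℕ → Set (StrongDual ℝ X))
    (hLRC : ∀ n, SmoothRenorm.IsWeakStarLRC (E n))
    (hcompact : SmoothRenorm.IsSigmaWeakStarCompact (⋃ n, E n))
    (hboundary : ∃ B ⊆ ⋃ n, E n, SmoothRenorm.IsBoundary B)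
    (k : ℕ∞) (hY : SmoothRenorm.IsSmoothNorm k (fun y : Y => ‖y‖))
    (ε : ℝ) (hε : 0 < ε) :
    ∃ p : Seminorm ℝ (SmoothRenorm.InjectiveTensorProduct X Y),
      SmoothRenorm.IsEquivalentNorm p ∧ SmoothRenorm.IsSmoothNorm k p ∧
        SmoothRenorm.Approximates ε p := by
  open SmoothRenorm in
  suffices h : ∃ p : Seminorm ℝ (InjectiveTensorProduct X Y),
      (∀ u, ‖u‖ ≤ p u ∧ p u ≤ (1 + ε) * ‖u‖) ∧ IsSmoothNorm k p by
    obtain ⟨p, hp, hpk⟩ := h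
    refine ⟨p, ⟨1, 1 + ε, one_pos, by linarith, fun u => ⟨?_, (hp u).2⟩⟩, hpk,
      fun u => ⟨?_, (hp u).2⟩⟩
    · rw [one_mul]
      exact (hp u).1
    · exact le_trans (by nlinarith [norm_nonneg u]) (hp u).1
  -- The implicit function theorem needs `k ≠ 0`; for `k = 0` the given norm is itself continuous.
  by_cases hk : k = 0
  · subst hk
    refine ⟨normSeminorm ℝ _, fun u => ⟨le_rfl, ?_⟩, ?_⟩
    · change ‖u‖ ≤ (1 + ε) * ‖u‖
      nlinarith [norm_nonneg u]
    · exact contDiffOn_zero.2 continuous_norm.continuousOn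
  obtain ⟨C, D, hCD, hC⟩ := exists_isLRCFamily hLRC hcompact
  obtain ⟨B, hBE, hB⟩ := hboundary
  -- The final constant is `(1 + 3 * a) / (1 - a / 8)`, which is at most `1 + 8 * a` for `a ≤ 1 /
  -- 8`.
  obtain ⟨a, ha0, ha, haε⟩ : ∃ a : ℝ, 0 < a ∧ a ≤ 1 / 8 ∧ 8 * a ≤ ε :=
    ⟨min (1 / 8) (ε / 8), by positivity, min_le_left _ _, by linarith [min_le_right (1 / 8) (ε / 8)]⟩
  let e : ℕ → ℝ := fun j => a / 2 / 2 ^ j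
  have he : ∀ j, 0 < e j := fun j => by positivity
  have hs : HasSum e a := hasSum_geometric_two' a
  have hea : ∀ j, e j ≤ a := fun j => le_hasSum hs j fun i _ => (he i).le
  obtain ⟨N, hN⟩ := exists_isLevelNet (C := C) (D := D) he
  have hbd : ∀ u : InjectiveTensorProduct X Y, u ≠ 0 → ∃ f j, f ∈ C j ∧ ‖slice f u‖ = ‖u‖ := by
    intro u hu
    obtain ⟨f, hfB, hfu⟩ := hB.exists_norm_slice_eq hu
    obtain ⟨j, hj⟩ := hC f (hBE hfB) (mem_closedBall_zero_iff.1 (hB.1 hfB))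
    exact ⟨f, j, hj, hfu⟩
  have hbound : ∀ (i : Σ j, N j) (u : InjectiveTensorProduct X Y),
      sliceSeminorm C D N e i u ≤ (1 + 3 * a) * ‖u‖ := by
    intro i u
    rw [sliceSeminorm_apply he]
    refine mul_le_mul ?_ (norm_slice_le_norm (hN.norm_le hCD i) u) (norm_nonneg _) (by linarith)
    linarith [weight_le (C := C) (D := D) he hs i.2, hea i.1]
  have hsmooth : ∀ (i : Σ j, N j) (u : InjectiveTensorProduct X Y),
      sliceSeminorm C D N e i u ≠ 0 →
        ContDiffAt ℝ k (sliceSeminorm (X := X) (Y := Y) C D N e i) u := by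
    intro i u hiu
    have hne : slice (i.2 : StrongDual ℝ X) u ≠ 0 := by
      intro h
      rw [sliceSeminorm_apply he, h, norm_zero, mul_zero] at hiu
      exact hiu rfl
    have h1 : ContDiffAt ℝ k (fun y : Y => ‖y‖) (slice (i.2 : StrongDual ℝ X) u) :=
      hY.contDiffAt (isOpen_compl_singleton.mem_nhds hne)
    have h2 := h1.comp u (slice (Y := Y) (i.2 : StrongDual ℝ X)).contDiff.contDiffAt
    refine ((contDiffAt_const (c := weight C D e i.2 + e i.1 / 8)).mul h2).congr_of_eventuallyEq ?_
    exact Filter.Eventually.of_forall fun v => sliceSeminorm_apply he i v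
  have hlow : ∀ u : InjectiveTensorProduct X Y, (∀ i, sliceSeminorm C D N e i u ≤ 1) →
      ‖u‖ ≤ 1 := by
    intro u hu
    by_cases hu0 : u = 0
    · simp [hu0]
    obtain ⟨f, j, hf, hfu⟩ := hbd u hu0
    have h1 := weight_mul_norm_slice_le_one hCD hN he hs ha hu hf
      (by rw [hfu]; linarith [norm_nonneg u])
    rw [hfu] at h1
    nlinarith [one_le_weight (C := C) (D := D) he f, norm_nonneg u]
  obtain ⟨p, hp, hpk⟩ := exists_smooth_seminorm (sliceSeminorm C D N e) (fun i => e i.1 / 8)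
    (τ₀ := a / 8) hk (by linarith) hbound (fun i => by linarith [he i.1])
    (fun i => by linarith [hea i.1]) (by linarith) hsmooth hlow
    (fun u hu0 hu => exists_finset_sliceSeminorm_le hCD hN he hs ha (hbd u hu0) hu)
  refine ⟨p, fun u => ⟨(hp u).1, (hp u).2.trans ?_⟩, hpk⟩
  gcongr
  rw [div_le_iff₀ (by linarith)]
  nlinarith
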